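/- Let $\Gamma$ be a finite graph (loops and parallel edges allowed) with a base vertex $b$ and a linear order on its edges. A state is a set $s$ of edges of $\Gamma$, viewed as a spanning subgraph. A reduced enhanced state is a state together with a colouring of its connected components by the two colours $1$ and $x$ such that the component of $b$ has colour $x$; its dimension is $|s|$ and its degree is the number of components coloured $x$, minus $1$. Let $\widetilde C^{i,j}(\Gamma)$ be the real vector space spanned by the reduced enhanced states of dimension $i$ and degree $j$, and let $d:\widetilde C^{i,j}(\Gamma)\to\widetilde C^{i+1,j}(\Gamma)$ send an enhanced state $S$ with edge set $s$ to $\sum_{f\notin s}(-1)^{|\{g\in s:\,g<f\}|}\,S\cup f$. Here, if adding $f$ does not change the number of components, then $S\cup f$ keeps the colouring of $S$; if $f$ joins two components, then the new component is coloured by the product of their colours, by the rule $1\cdot 1=1$, $1\cdot x=x\cdot 1=x$, where $S\cup f:=0$ if both colours are $x$, and the other components keep their colours. Put $$\widetilde H^{i,j}(\Gamma)=\frac{\ker(d:\widetilde C^{i,j}(\Gamma)\to\widetilde C^{i+1,j}(\Gamma))}{\operatorname{im}(d:\widetilde C^{i-1,j}(\Gamma)\to\widetilde C^{i,j}(\Gamma))},\qquad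 \widetilde R_\Gamma(t,q)=\sum_{i,j}t^iq^j\dim_{\mathbb R}\widetilde H^{i,j}(\Gamma)\in\mathbb Z[t,q].$$ Proposition. Let $\Gamma$ be a finite simple connected graph and let $e$ be an edge of $\Gamma$ that is not a bridge. Let $\Gamma-e$ be obtained from $\Gamma$ by removing $e$, and let $\Gamma/e$ be obtained by removing $e$ and identifying its two end points. Then $$\widetilde R_\Gamma(t,q)=t\,\widetilde R_{\Gamma/e}(t,q)+\widetilde R_{\Gamma-e}(t,q).$$ This holds whatever base vertices and edge orders are chosen, independently of each other, for the three graphs $\Gamma$, $\Gamma/e$ and $\Gamma-e$. It holds both when the parallel edges that may arise in $\Gamma/e$ are kept and when each class of them is replaced by a single edge. -/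

import Mathlib

/-- A graph with vertex type `V` and edge type `E`, given by the unordered pair of end points of
each edge.  Parallel edges and loops are allowed; the graph is finite when `V` and `E` are. -/
structure IncidenceGraph (V E : Type*) where
  ends : E → Sym2 V

/-- A simple graph, with its edge set as the type of edges. -/
def SimpleGraph.toIncidenceGraph {V : Type*} (G : SimpleGraph V) :
    IncidenceGraph V G.edgeSet where
  ends f := f.1

/-- The vertices of `Γ / e`: the end points of `e` are identified. -/
def ContractedVertex {V : Type*} (e : Sym2 V) : Type _ :=
  Quot (fun u v : V => s(u, v) = e)

/-- The projection of the vertices of `Γ` onto those of `Γ / e`. -/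
def ContractedVertex.mk {V : Type*} (e : Sym2 V) (v : V) : ContractedVertex e :=
  Quot.mk _ v

/-- The contraction `Γ / e` of a simple graph: the end points of `e` are identified and `e` is
removed.  Each remaining edge is kept, so parallel edges may arise. -/
def SimpleGraph.contractEdge {V : Type*} (G : SimpleGraph V) (e : Sym2 V) :
    IncidenceGraph (ContractedVertex e) ↥(G.edgeSet \ {e}) where
  ends f := Sym2.map (ContractedVertex.mk e) f.1

/-- The contraction `Γ / e` of a simple graph, with parallel edges replaced by single edges. -/
def SimpleGraph.simpleContractEdge {V : Type*} (G : SimpleGraph V) (e : Sym2 V) :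
    SimpleGraph (ContractedVertex e) :=
  SimpleGraph.fromEdgeSet (Sym2.map (ContractedVertex.mk e) '' (G.edgeSet \ {e}))

/-- The two colours of the components of an enhanced state. -/
inductive Colour
  | one
  | x

/-- The multiplication rule for colours, where `none` stands for `0`. -/
def Colour.mul : Colour → Colour → Option Colour
  | .one, .one => some .one
  | .one, .x => some .x
  | .x, .one => some .x
  | .x, .x => none

namespace IncidenceGraph

variable {V E : Type*}

/-- The spanning subgraph with edge set `s`, considered up to loops and parallel edges, which do
not influence the connected components. -/
def state (Γ : IncidenceGraph V E) (s : Set E) : SimpleGraph V :=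
  SimpleGraph.fromEdgeSet (Γ.ends '' s)

/-- A reduced enhanced state with base point `b`: a spanning subgraph together with a colouring of
its connected components, where the component of `b` has the colour `x`.  The colouring is
recorded as a function on vertices that is constant on components. -/
@[ext]
structure EnhancedState (Γ : IncidenceGraph V E) (b : V) where
  edges : Set E
  colour : V → Colour
  colour_eq : ∀ u v, (Γ.state edges).Reachable u v → colour u = colour v
  colour_base : colour b = Colour.x

variable {Γ : IncidenceGraph V E} {b : V}

/-- The number of edges. -/
noncomputable def EnhancedState.dimension (S : Γ.EnhancedState b) : ℤ :=
  (S.edges.ncard : ℤ)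

/-- The number of connected components coloured in `x`, minus `1`. -/
noncomputable def EnhancedState.degree (S : Γ.EnhancedState b) : ℤ :=
  ({K : (Γ.state S.edges).ConnectedComponent |
    ∃ v ∈ K.supp, S.colour v = Colour.x}.ncard : ℤ) - 1

/-- `S'` is the enhanced state obtained from `S` by adding the edge `e`.  Components that do not
contain an end point of `e` keep their colours.  If the two end points of `e` lie in one component
of `S`, then it keeps its colour; otherwise the colour of the new component is the product of the
colours of the two components that `e` connects.  If this product is `0`, there is no such `S'`. -/
structure EnhancedState.AddsEdge (S : Γ.EnhancedState b) (e : E) (S' : Γ.EnhancedState b) :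
    Prop where
  edges : S'.edges = insert e S.edges
  colour_far : ∀ w, (∀ u ∈ Γ.ends e, ¬ (Γ.state S.edges).Reachable u w) →
    S'.colour w = S.colour w
  colour_same : ∀ u v, Γ.ends e = s(u, v) → (Γ.state S.edges).Reachable u v →
    S'.colour u = S.colour u
  colour_merge : ∀ u v, Γ.ends e = s(u, v) → ¬ (Γ.state S.edges).Reachable u v →
    Colour.mul (S.colour u) (S.colour v) = some (S'.colour u)

variable (Γ b)

/-- The real vector space spanned by all reduced enhanced states. -/
def Cochain : Type _ := Γ.EnhancedState b →₀ ℝ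

noncomputable instance : AddCommGroup (Γ.Cochain b) :=
  inferInstanceAs (AddCommGroup (Γ.EnhancedState b →₀ ℝ))

noncomputable instance : Module ℝ (Γ.Cochain b) :=
  inferInstanceAs (Module ℝ (Γ.EnhancedState b →₀ ℝ))

variable {Γ b} in
/-- The basis vector given by an enhanced state. -/
noncomputable def EnhancedState.toCochain (S : Γ.EnhancedState b) : Γ.Cochain b :=
  Finsupp.single S (1 : ℝ)

/-- The cochain group `C^{i,j}`: the span of the enhanced states of dimension `i` and degree `j`. -/
noncomputable def cochainGroup (i j : ℤ) : Submodule ℝ (Γ.Cochain b) :=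
  Submodule.span ℝ {c | ∃ S : Γ.EnhancedState b, S.dimension = i ∧ S.degree = j ∧
    c = S.toCochain}

/-- The differential: the sum over all ways of adding an edge `e`, with the sign `(-1) ^ k`, where
`k` is the number of edges of the state that precede `e` in the given order.  For each `e` there
is at most one `S'` in the inner sum. -/
noncomputable def differential (ord : LinearOrder E) : Γ.Cochain b →ₗ[ℝ] Γ.Cochain b :=
  Finsupp.linearCombination ℝ (fun S : Γ.EnhancedState b =>
    ∑ᶠ e : {e : E // e ∉ S.edges}, ∑ᶠ S' : {S' : Γ.EnhancedState b // S.AddsEdge e.1 S'},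
      ((-1 : ℝ) ^ {f : E | f ∈ S.edges ∧ ord.lt f e.1}.ncard) • S'.1.toCochain)

/-- The kernel of `d : C^{i,j} → C^{i+1,j}`. -/
noncomputable def cocycles (ord : LinearOrder E) (i j : ℤ) : Submodule ℝ (Γ.Cochain b) :=
  Γ.cochainGroup b i j ⊓ LinearMap.ker (Γ.differential b ord)

/-- The image of `d : C^{i-1,j} → C^{i,j}`. -/
noncomputable def coboundaries (ord : LinearOrder E) (i j : ℤ) : Submodule ℝ (Γ.Cochain b) :=
  (Γ.cochainGroup b (i - 1) j).map (Γ.differential b ord)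

/-- The reduced chromatic cohomology group `H^{i,j}`. -/
abbrev ReducedCohomology (ord : LinearOrder E) (i j : ℤ) : Type _ :=
  Γ.cocycles b ord i j ⧸ (Γ.coboundaries b ord i j).submoduleOf (Γ.cocycles b ord i j)

/-- The Poincaré polynomial `∑ t ^ i * q ^ j * dim H^{i,j}` of a finite graph, with `t = X 0` and
`q = X 1`.  There are no enhanced states of dimension greater than the number of edges, nor of
degree negative or at least the number of vertices, so that the sum runs over all `i` and `j` with
a cochain group that is not zero. -/
noncomputable def poincarePolynomial (ord : LinearOrder E) : MvPolynomial (Fin 2) ℤ :=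
  ∑ i ∈ Finset.range (Nat.card E + 1), ∑ j ∈ Finset.range (Nat.card V),
    MvPolynomial.C (Module.finrank ℝ (Γ.ReducedCohomology b ord i j) : ℤ) *
      MvPolynomial.X 0 ^ i * MvPolynomial.X 1 ^ j

end IncidenceGraph

/-! The point is that the reduced cohomology of a connected graph lives on a single diagonal, `i + j
= |V| - 1`. For each degree `j` at most one group is nonzero, so its dimension is, up to a known
sign, the Euler characteristic of the complex in degree `j`, and the whole polynomial is determined
by these Euler characteristics (`poincarePolynomial_eq`). They can be computed from the states: they
are the sums over edge sets `s` of `(-1) ^ |s|` times `k(s) - 1` choose `j`, where `k(s)` counts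
components. Base vertex and edge order have disappeared. Splitting the sum by whether `s` contains
`e` gives deletion-contraction (`eulerChar_deletion_contraction`), and merging parallel edges does
not change the sum (`eulerChar_eq_of_surjective`). All graphs involved are connected, `Γ - e`
because `e` is not a bridge. As `Γ / e` has one vertex fewer, its diagonal is shifted by one, which
accounts for the factor `t` and for the change of sign.

Concentration (`isExactAt_of_connected`) is proved for all minors at once. Contracting `A` and
keeping only the edges of `T` is modelled inside the complex of one graph, by the states `s` with `A
⊆ s ⊆ T`; only the differential is restricted to the edges of `T`. The induction is on `|T \ A|`.
Take an edge `f` of `T` from the component of `b` in `A` to another component. If `f` is not a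
bridge of the minor, then the states with `f` form a subcomplex, those without `f` the quotient, and
both are exact off the same diagonal. If `f` is a bridge, then every cocycle is cohomologous to one
on states without `f` in which the far end lies in a second component coloured `x`
(`exists_cohomologous`), and these form a shifted copy of the contracted complex. If there is no
such `f`, then `A` is connected: either `T = A` and there is just one state, or some edge is a loop
of the minor, which makes the complex acyclic. -/

namespace IncidenceGraph

variable {V E : Type*} {Γ : IncidenceGraph V E} {b : V}

/-! ### Components of a state and the effect of one more edge -/

section Reachability

lemma reachable_mono {s t : Set E} (h : s ⊆ t) {u v : V} (huv : (Γ.state s).Reachable u v) :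
    (Γ.state t).Reachable u v :=
  huv.mono (SimpleGraph.fromEdgeSet_mono (Set.image_mono h))

lemma reachable_of_ends {s : Set E} {f : E} (hf : f ∈ s) {u v : V} (h : Γ.ends f = s(u, v)) :
    (Γ.state s).Reachable u v := by
  by_cases huv : u = v
  · subst huv; rfl
  · refine SimpleGraph.Adj.reachable ?_
    rw [state, SimpleGraph.fromEdgeSet_adj]
    exact ⟨⟨f, hf, h⟩, huv⟩

/-- Reachability is the least equivalence relation that relates the end points of each edge. -/
lemma reachable_least {s : Set E} {R : V → V → Prop} (hR : Equivalence R)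
    (h : ∀ f ∈ s, ∀ u v, Γ.ends f = s(u, v) → R u v) {u v : V}
    (huv : (Γ.state s).Reachable u v) : R u v := by
  obtain ⟨p⟩ := huv
  induction p with
  | nil => exact hR.refl _
  | cons hadj _ ih =>
    rw [state, SimpleGraph.fromEdgeSet_adj] at hadj
    obtain ⟨⟨f, hf, hfe⟩, -⟩ := hadj
    exact hR.trans (h f hf _ _ hfe) ih

/-- No walk needs `f` more than once. Formally, the right-hand side is already an equivalence
relation that contains the edges, so minimality of reachability applies. -/
lemma reachable_insert {s : Set E} {f : E} {a c : V} (hf : Γ.ends f = s(a, c)) {u v : V} :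
    (Γ.state (insert f s)).Reachable u v ↔ (Γ.state s).Reachable u v ∨
      ((Γ.state s).Reachable u a ∧ (Γ.state s).Reachable c v) ∨
      ((Γ.state s).Reachable u c ∧ (Γ.state s).Reachable a v) := by
  have hsub : s ⊆ insert f s := Set.subset_insert f s
  have hac : (Γ.state (insert f s)).Reachable a c :=
    reachable_of_ends (Set.mem_insert f s) hf
  constructor
  · refine reachable_least (R := fun u v => (Γ.state s).Reachable u v ∨
      ((Γ.state s).Reachable u a ∧ (Γ.state s).Reachable c v) ∨
      ((Γ.state s).Reachable u c ∧ (Γ.state s).Reachable a v)) ⟨?_, ?_, ?_⟩ ?_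
    · exact fun u => Or.inl (SimpleGraph.Reachable.refl u)
    · rintro x y (h | ⟨h1, h2⟩ | ⟨h1, h2⟩)
      · exact Or.inl h.symm
      · exact Or.inr (Or.inr ⟨h2.symm, h1.symm⟩)
      · exact Or.inr (Or.inl ⟨h2.symm, h1.symm⟩)
    · rintro x y z (h | ⟨h1, h2⟩ | ⟨h1, h2⟩) (h' | ⟨h3, h4⟩ | ⟨h3, h4⟩)
      · exact Or.inl (h.trans h')
      · exact Or.inr (Or.inl ⟨h.trans h3, h4⟩)
      · exact Or.inr (Or.inr ⟨h.trans h3, h4⟩)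
      · exact Or.inr (Or.inl ⟨h1, h2.trans h'⟩)
      · exact Or.inr (Or.inl ⟨h1, h4⟩)
      · exact Or.inl (h1.trans h4)
      · exact Or.inr (Or.inr ⟨h1, h2.trans h'⟩)
      · exact Or.inl (h1.trans h4)
      · exact Or.inr (Or.inr ⟨h1, h4⟩)
    · rintro g (rfl | hg) x y hxy
      · rw [hf, Sym2.eq_iff] at hxy
        rcases hxy with ⟨rfl, rfl⟩ | ⟨rfl, rfl⟩
        · exact Or.inr (Or.inl ⟨SimpleGraph.Reachable.refl _, SimpleGraph.Reachable.refl _⟩)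
        · exact Or.inr (Or.inr ⟨SimpleGraph.Reachable.refl _, SimpleGraph.Reachable.refl _⟩)
      · exact Or.inl (reachable_of_ends hg hxy)
  · rintro (h | ⟨h1, h2⟩ | ⟨h1, h2⟩)
    · exact reachable_mono hsub h
    · exact ((reachable_mono hsub h1).trans hac).trans (reachable_mono hsub h2)
    · exact ((reachable_mono hsub h1).trans hac.symm).trans (reachable_mono hsub h2)

end Reachability

/-! ### Adding several edges at once -/

namespace EnhancedState

/-- `S'` arises from `S` by adding edges, where no two components coloured `x` are joined. -/
structure Specializes (S S' : Γ.EnhancedState b) : Prop where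
  subset : S.edges ⊆ S'.edges
  colour_iff : ∀ v, S'.colour v = Colour.x ↔
    ∃ u, S.colour u = Colour.x ∧ (Γ.state S'.edges).Reachable u v
  separated : ∀ u v, S.colour u = Colour.x → S.colour v = Colour.x →
    (Γ.state S'.edges).Reachable u v → (Γ.state S.edges).Reachable u v

lemma colour_ext {c c' : Colour} (h : c = Colour.x ↔ c' = Colour.x) : c = c' := by
  cases c <;> cases c' <;> simp_all

lemma ext_of_colour_iff {S S' : Γ.EnhancedState b} (h : S.edges = S'.edges)
    (hc : ∀ v, S.colour v = Colour.x ↔ S'.colour v = Colour.x) : S = S' :=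
  EnhancedState.ext h (funext fun v => colour_ext (hc v))

/-- The colouring of the target is forced by its edge set, so the differential has at most one term
for each added edge. -/
lemma Specializes.unique {S S₁ S₂ : Γ.EnhancedState b} (h₁ : S.Specializes S₁)
    (h₂ : S.Specializes S₂) (h : S₁.edges = S₂.edges) : S₁ = S₂ := by
  refine ext_of_colour_iff h fun v => ?_
  rw [h₁.colour_iff, h₂.colour_iff, h]

lemma Specializes.trans {S S' S'' : Γ.EnhancedState b} (h : S.Specializes S')
    (h' : S'.Specializes S'') : S.Specializes S'' where
  subset := h.subset.trans h'.subset
  colour_iff v := by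
    rw [h'.colour_iff]
    constructor
    · rintro ⟨u, hu, huv⟩
      obtain ⟨w, hw, hwu⟩ := (h.colour_iff u).1 hu
      exact ⟨w, hw, (reachable_mono h'.subset hwu).trans huv⟩
    · rintro ⟨u, hu, huv⟩
      exact ⟨u, (h.colour_iff u).2 ⟨u, hu, SimpleGraph.Reachable.refl u⟩, huv⟩
  separated u v hu hv huv :=
    h.separated u v hu hv <| h'.separated u v
      ((h.colour_iff u).2 ⟨u, hu, SimpleGraph.Reachable.refl u⟩)
      ((h.colour_iff v).2 ⟨v, hv, SimpleGraph.Reachable.refl v⟩) huv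

open Classical in
/-- The enhanced state with edge set `t` whose components coloured `x` are those that contain a
vertex coloured `x` in `S`. -/
noncomputable def saturate (S : Γ.EnhancedState b) (t : Set E) : Γ.EnhancedState b where
  edges := t
  colour v := if ∃ u, S.colour u = Colour.x ∧ (Γ.state t).Reachable u v then Colour.x
    else Colour.one
  colour_eq v w hvw := by
    have : (∃ u, S.colour u = Colour.x ∧ (Γ.state t).Reachable u v) ↔
        ∃ u, S.colour u = Colour.x ∧ (Γ.state t).Reachable u w :=
      ⟨fun ⟨u, hu, h⟩ => ⟨u, hu, h.trans hvw⟩, fun ⟨u, hu, h⟩ => ⟨u, hu, h.trans hvw.symm⟩⟩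
    simp only [this]
  colour_base := if_pos ⟨b, S.colour_base, SimpleGraph.Reachable.refl b⟩

lemma saturate_colour_iff (S : Γ.EnhancedState b) (t : Set E) (v : V) :
    (S.saturate t).colour v = Colour.x ↔
      ∃ u, S.colour u = Colour.x ∧ (Γ.state t).Reachable u v := by
  simp [saturate]

lemma specializes_saturate {S : Γ.EnhancedState b} {t : Set E} (ht : S.edges ⊆ t)
    (h : ∀ u v, S.colour u = Colour.x → S.colour v = Colour.x →
      (Γ.state t).Reachable u v → (Γ.state S.edges).Reachable u v) :
    S.Specializes (S.saturate t) :=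
  ⟨ht, S.saturate_colour_iff t, h⟩

/-- If no two components coloured `x` meet in the end, none meet on the way. Hence the order in
which edges are added does not matter for whether the result is zero. -/
lemma Specializes.factor {S S'' : Γ.EnhancedState b} (h : S.Specializes S'') {t : Set E}
    (ht : S.edges ⊆ t) (ht' : t ⊆ S''.edges) :
    S.Specializes (S.saturate t) ∧ (S.saturate t).Specializes S'' := by
  refine ⟨specializes_saturate ht fun u v hu hv huv =>
    h.separated u v hu hv (reachable_mono ht' huv), ⟨ht', fun v => ?_, fun u v hu hv huv => ?_⟩⟩
  · rw [h.colour_iff]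
    constructor
    · rintro ⟨u, hu, huv⟩
      exact ⟨u, (S.saturate_colour_iff t u).2 ⟨u, hu, SimpleGraph.Reachable.refl u⟩, huv⟩
    · rintro ⟨u, hu, huv⟩
      obtain ⟨w, hw, hwu⟩ := (S.saturate_colour_iff t u).1 hu
      exact ⟨w, hw, (reachable_mono ht' hwu).trans huv⟩
  · obtain ⟨u', hu', huu⟩ := (S.saturate_colour_iff t u).1 hu
    obtain ⟨v', hv', hvv⟩ := (S.saturate_colour_iff t v).1 hv
    have := h.separated u' v' hu' hv'
      (((reachable_mono ht' huu).trans huv).trans (reachable_mono ht' hvv).symm)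
    exact (huu.symm.trans (reachable_mono ht this)).trans hvv

lemma colour_x_of_reachable {S : Γ.EnhancedState b} {u v : V} (hu : S.colour u = Colour.x)
    (h : (Γ.state S.edges).Reachable u v) : S.colour v = Colour.x :=
  (S.colour_eq u v h).symm.trans hu

/-- Replaces the case distinction of the colour rule by the transitive notion of specialization, in
which sequences of edges are easy to handle. -/
theorem addsEdge_iff {S S' : Γ.EnhancedState b} {f : E} :
    S.AddsEdge f S' ↔ S'.edges = insert f S.edges ∧ S.Specializes S' := by
  obtain ⟨a, c, hac⟩ : ∃ a c, Γ.ends f = s(a, c) :=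
    ⟨_, _, (Sym2.mk_surjective (Γ.ends f)).choose_spec.symm⟩
  have hx : ∀ c : Colour, c = Colour.one ∨ c = Colour.x := by rintro (_ | _) <;> simp
  have hrefl : ∀ u, (Γ.state S.edges).Reachable u u := SimpleGraph.Reachable.refl
  have hcol' := S'.colour_eq
  constructor
  · intro h
    have he := h.edges
    have hins := fun u v => reachable_insert (Γ := Γ) (s := S.edges) hac (u := u) (v := v)
    have hfar := h.colour_far
    have hsame := h.colour_same a c hac
    have hmerge := h.colour_merge a c hac
    simp only [hac, Sym2.mem_iff, forall_eq_or_imp, forall_eq] at hfar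
    rw [← he] at hins
    have hcol'ac := hcol' a c ((hins a c).2 (Or.inr (Or.inl ⟨hrefl _, hrefl _⟩)))
    -- The multiplication table: a product is zero only for `x · x`, and otherwise it is `x` exactly
    -- when one factor is.
    have key : ¬ (Γ.state S.edges).Reachable a c →
        ¬ (S.colour a = Colour.x ∧ S.colour c = Colour.x) ∧
        (S'.colour a = Colour.x ↔ S.colour a = Colour.x ∨ S.colour c = Colour.x) := by
      intro hn
      have := hmerge hn
      rcases hx (S.colour a) with h1 | h1 <;> rcases hx (S.colour c) with h2 | h2 <;>
        rw [h1, h2] at this <;> simp [Colour.mul] at this <;> simp [h1, h2, ← this]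
    refine ⟨he, ⟨he ▸ Set.subset_insert f _, fun v => ?_, fun u v hu hv huv => ?_⟩⟩
    · by_cases hva : (Γ.state S'.edges).Reachable a v
      · rw [← hcol' a v hva]
        by_cases hr : (Γ.state S.edges).Reachable a c
        · rw [hsame hr]
          refine ⟨fun h => ⟨a, h, hva⟩, ?_⟩
          rintro ⟨u, hu, huv⟩
          have hua := (hins u a).1 (huv.trans hva.symm)
          have : (Γ.state S.edges).Reachable u a := by
            rcases hua with h | ⟨h, -⟩ | ⟨h, -⟩
            · exact h
            · exact h
            · exact h.trans hr.symm
          exact colour_x_of_reachable hu this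
        · rw [(key hr).2]
          constructor
          · rintro (h | h)
            · exact ⟨a, h, hva⟩
            · exact ⟨c, h, ((hins c a).2 (Or.inr (Or.inr ⟨hrefl _, hrefl _⟩))).trans hva⟩
          · rintro ⟨u, hu, huv⟩
            rcases (hins u a).1 (huv.trans hva.symm) with h | ⟨h, -⟩ | ⟨h, -⟩
            · exact Or.inl (colour_x_of_reachable hu h)
            · exact Or.inl (colour_x_of_reachable hu h)
            · exact Or.inr (colour_x_of_reachable hu h)
      · have hva' : ¬ (Γ.state S.edges).Reachable a v := fun h => hva ((hins a v).2 (Or.inl h))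
        have hvc' : ¬ (Γ.state S.edges).Reachable c v := fun h =>
          hva ((hins a v).2 (Or.inr (Or.inl ⟨hrefl _, h⟩)))
        rw [hfar v ⟨hva', hvc'⟩]
        refine ⟨fun h => ⟨v, h, SimpleGraph.Reachable.refl v⟩, ?_⟩
        rintro ⟨u, hu, huv⟩
        rcases (hins u v).1 huv with h | ⟨-, h⟩ | ⟨-, h⟩
        · exact colour_x_of_reachable hu h
        · exact absurd h hvc'
        · exact absurd h hva'
    · by_contra hn
      rcases (hins u v).1 huv with h | ⟨h1, h2⟩ | ⟨h1, h2⟩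
      · exact hn h
      · exact (key fun h => hn ((h1.trans h).trans h2)).1
          ⟨colour_x_of_reachable hu h1, colour_x_of_reachable hv h2.symm⟩
      · exact (key fun h => hn ((h1.trans h.symm).trans h2)).1
          ⟨colour_x_of_reachable hv h2.symm, colour_x_of_reachable hu h1⟩
  · rintro ⟨he, h⟩
    have hciff := h.colour_iff
    have hsep := h.separated
    rw [he] at hciff hsep
    refine ⟨he, fun w hw => ?_, fun u v huv hr => ?_, fun u v huv hr => ?_⟩
    · simp only [hac, Sym2.mem_iff, forall_eq_or_imp, forall_eq] at hw
      refine colour_ext ?_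
      rw [hciff]
      constructor
      · rintro ⟨u, hu, huw⟩
        rcases (reachable_insert hac).1 huw with h | ⟨-, h⟩ | ⟨-, h⟩
        · exact colour_x_of_reachable hu h
        · exact absurd h hw.2
        · exact absurd h hw.1
      · exact fun h => ⟨w, h, SimpleGraph.Reachable.refl w⟩
    · refine colour_ext ?_
      rw [hciff]
      refine ⟨?_, fun h => ⟨u, h, SimpleGraph.Reachable.refl u⟩⟩
      rintro ⟨w, hw, hwu⟩
      rcases (reachable_insert huv).1 hwu with h | ⟨h, -⟩ | ⟨h, -⟩
      · exact colour_x_of_reachable hw h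
      · exact colour_x_of_reachable hw h
      · exact colour_x_of_reachable hw (h.trans hr.symm)
    · have hxx : ¬ (S.colour u = Colour.x ∧ S.colour v = Colour.x) := fun ⟨h1, h2⟩ =>
        hr (hsep u v h1 h2 (reachable_of_ends (Set.mem_insert f _) huv))
      have hu : S'.colour u = Colour.x ↔ S.colour u = Colour.x ∨ S.colour v = Colour.x := by
        rw [hciff]
        constructor
        · rintro ⟨w, hw, hwu⟩
          rcases (reachable_insert huv).1 hwu with h | ⟨h, -⟩ | ⟨h, -⟩
          · exact Or.inl (colour_x_of_reachable hw h)
          · exact Or.inl (colour_x_of_reachable hw h)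
          · exact Or.inr (colour_x_of_reachable hw h)
        · rintro (h | h)
          · exact ⟨u, h, SimpleGraph.Reachable.refl u⟩
          · exact ⟨v, h, (reachable_of_ends (Set.mem_insert f _) huv).symm⟩
      rcases hx (S.colour u) with h1 | h1 <;> rcases hx (S.colour v) with h2 | h2 <;>
        rcases hx (S'.colour u) with h3 | h3 <;> simp [h1, h2, h3, Colour.mul] at hu hxx ⊢

end EnhancedState

/-! ### The differential as a sum of anticommuting one-edge operators -/

section Operators

open Classical

variable {V E : Type*} {Γ : IncidenceGraph V E} {b : V}

lemma linearMap_eq_of_supported {α M : Type*} [AddCommGroup M] [Module ℝ M] {P : Set α}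
    {L₁ L₂ : (α →₀ ℝ) →ₗ[ℝ] M}
    (h : ∀ a ∈ P, L₁ (Finsupp.single a 1) = L₂ (Finsupp.single a 1)) {c : α →₀ ℝ}
    (hc : c ∈ Finsupp.supported ℝ ℝ P) : L₁ c = L₂ c := by
  rw [Finsupp.supported_eq_span_single] at hc
  refine LinearMap.eqOn_span (f := L₁) (g := L₂) ?_ hc
  rintro _ ⟨a, ha, rfl⟩
  exact h a ha

lemma linearMap_mem_of_supported {α M : Type*} [AddCommGroup M] [Module ℝ M] {P : Set α}
    {L : (α →₀ ℝ) →ₗ[ℝ] M} {N : Submodule ℝ M}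
    (h : ∀ a ∈ P, L (Finsupp.single a 1) ∈ N) {c : α →₀ ℝ}
    (hc : c ∈ Finsupp.supported ℝ ℝ P) : L c ∈ N := by
  rw [Finsupp.supported_eq_span_single] at hc
  have : Submodule.span ℝ ((fun i => Finsupp.single i (1 : ℝ)) '' P) ≤ N.comap L := by
    rw [Submodule.span_le]
    rintro _ ⟨a, ha, rfl⟩
    exact h a ha
  exact this hc

/-- A relation on the edges that holds in exactly one direction between two distinct edges. -/
structure EdgeOrder (E : Type*) where
  lt : E → E → Prop
  lt_iff_not_lt : ∀ {f g}, f ≠ g → (lt f g ↔ ¬ lt g f)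

/-- The strict order of a linear order on the edges. -/
def EdgeOrder.ofLinearOrder {E : Type*} (ord : LinearOrder E) : EdgeOrder E where
  lt := ord.lt
  lt_iff_not_lt {f g} h := by
    have h1 : ord.lt g f ∨ ord.lt f g := @lt_or_gt_of_ne E ord g f h.symm
    have h2 : ord.lt f g → ¬ ord.lt g f := @lt_asymm E ord.toPreorder f g
    tauto

/-- The sign `(-1) ^ k`, where `k` is the number of elements of `s` that precede `f`. -/
noncomputable def edgeSign (ord : EdgeOrder E) (f : E) (s : Set E) : ℝ :=
  (-1) ^ {g : E | g ∈ s ∧ ord.lt g f}.ncard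

lemma edgeSign_mul_self (ord : EdgeOrder E) (f : E) (s : Set E) :
    edgeSign ord f s * edgeSign ord f s = 1 := by
  rw [edgeSign, ← mul_pow]; simp

lemma edgeSign_insert [Finite E] (ord : EdgeOrder E) {f g : E} {s : Set E} (hg : g ∉ s) :
    edgeSign ord f (insert g s) = (if ord.lt g f then -1 else 1) * edgeSign ord f s := by
  unfold edgeSign
  split_ifs with h
  · have : {x | x ∈ insert g s ∧ ord.lt x f} = insert g {x | x ∈ s ∧ ord.lt x f} := by
      ext x
      simp only [Set.mem_insert_iff, Set.mem_ofPred_eq]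
      constructor
      · rintro ⟨rfl | hx, h'⟩
        · exact Or.inl rfl
        · exact Or.inr ⟨hx, h'⟩
      · rintro (rfl | ⟨hx, h'⟩)
        · exact ⟨Or.inl rfl, h⟩
        · exact ⟨Or.inr hx, h'⟩
    rw [this, Set.ncard_insert_of_notMem (fun h => hg h.1) (Set.toFinite _), pow_succ, mul_comm]
  · have : {x | x ∈ insert g s ∧ ord.lt x f} = {x | x ∈ s ∧ ord.lt x f} := by
      ext x
      simp only [Set.mem_insert_iff, Set.mem_ofPred_eq]
      constructor
      · rintro ⟨rfl | hx, h'⟩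
        · exact absurd h' h
        · exact ⟨hx, h'⟩
      · exact fun h => ⟨Or.inr h.1, h.2⟩
    rw [this, one_mul]

/-- Exactly one of `f`, `g` precedes the other, so exactly one of the two signs changes on
insertion. Transitivity of the order plays no role. -/
lemma edgeSign_swap [Finite E] (ord : EdgeOrder E) {f g : E} (hfg : f ≠ g) {s : Set E}
    (hf : f ∉ s) (hg : g ∉ s) :
    edgeSign ord g s * edgeSign ord f (insert g s) =
      - (edgeSign ord f s * edgeSign ord g (insert f s)) := by
  rw [edgeSign_insert ord hf, edgeSign_insert ord hg]
  have h := ord.lt_iff_not_lt hfg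
  split_ifs <;> first | tauto | ring

namespace EnhancedState

/-- The basis vector of the specialization of `S` with edge set `t`, or `0` if there is none. -/
noncomputable def push (t : Set E) (S : Γ.EnhancedState b) : Γ.EnhancedState b →₀ ℝ :=
  if S.Specializes (S.saturate t) then Finsupp.single (S.saturate t) 1 else 0

lemma Specializes.saturate_eq {S S' : Γ.EnhancedState b} (h : S.Specializes S') :
    S.saturate S'.edges = S' :=
  (h.factor h.subset subset_rfl).1.unique h rfl

lemma Specializes.push_eq {S S' : Γ.EnhancedState b} (h : S.Specializes S') {t : Set E}
    (ht : S'.edges = t) : S.push t = Finsupp.single S' 1 := by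
  subst ht
  rw [push, h.saturate_eq, if_pos h]

lemma push_eq_zero {S : Γ.EnhancedState b} {t : Set E}
    (h : ∀ S' : Γ.EnhancedState b, S'.edges = t → ¬ S.Specializes S') : S.push t = 0 :=
  if_neg (h _ rfl)

lemma push_eq_zero_or (S : Γ.EnhancedState b) (t : Set E) : S.push t = 0 ∨
    ∃ S' : Γ.EnhancedState b, S'.edges = t ∧ S.Specializes S' ∧ S.push t = Finsupp.single S' 1 := by
  unfold push
  split_ifs with h
  · exact Or.inr ⟨_, rfl, h, rfl⟩
  · exact Or.inl rfl

end EnhancedState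

open EnhancedState

/-- The part of the differential that adds the edge `f`. -/
noncomputable def addEdge (ord : EdgeOrder E) (f : E) :
    (Γ.EnhancedState b →₀ ℝ) →ₗ[ℝ] (Γ.EnhancedState b →₀ ℝ) :=
  Finsupp.linearCombination ℝ fun S =>
    if f ∈ S.edges then 0 else edgeSign ord f S.edges • S.push (insert f S.edges)

variable (ord : EdgeOrder E)

lemma addEdge_single (f : E) (S : Γ.EnhancedState b) :
    addEdge ord f (Finsupp.single S 1) =
      if f ∈ S.edges then 0 else edgeSign ord f S.edges • S.push (insert f S.edges) := by
  simp [addEdge, Finsupp.linearCombination_single]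

lemma addEdge_single_of_mem {f : E} {S : Γ.EnhancedState b} (h : f ∈ S.edges) :
    addEdge ord f (Finsupp.single S 1) = 0 := by
  rw [addEdge_single, if_pos h]

lemma addEdge_single_of_notMem {f : E} {S : Γ.EnhancedState b} (h : f ∉ S.edges) :
    addEdge ord f (Finsupp.single S 1) = edgeSign ord f S.edges • S.push (insert f S.edges) := by
  rw [addEdge_single, if_neg h]

/-- When the push to `t` vanishes, so does the push to the larger set, since a specialization with
the larger edge set would factor through `t`. -/
lemma addEdge_push {f : E} {S : Γ.EnhancedState b} {t : Set E} (hS : S.edges ⊆ t) (hf : f ∉ t) :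
    addEdge ord f (S.push t) = edgeSign ord f t • S.push (insert f t) := by
  rcases S.push_eq_zero_or t with h | ⟨S', rfl, hS', h⟩
  · rw [h, map_zero, push_eq_zero, smul_zero]
    intro S'' h'' hsp
    have := (hsp.factor hS (h''.symm ▸ Set.subset_insert f t)).1
    rw [this.push_eq (t := t) rfl] at h
    exact one_ne_zero (Finsupp.single_eq_zero.1 h)
  · rw [h, addEdge_single_of_notMem ord hf]
    congr 1
    rcases S'.push_eq_zero_or (insert f S'.edges) with h0 | ⟨S'', h1, hS'', h2⟩
    · rw [h0, push_eq_zero]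
      intro S'' h'' hsp
      have hfac := hsp.factor hS (h''.symm ▸ Set.subset_insert f _)
      rw [hS'.saturate_eq] at hfac
      rw [hfac.2.push_eq h''] at h0
      exact one_ne_zero (Finsupp.single_eq_zero.1 h0)
    · rw [h2, (hS'.trans hS'').push_eq h1]

/-- By `addEdge_push` both composites reach the same state or both vanish; the sign is
`edgeSign_swap`. -/
lemma addEdge_anticomm [Finite E] {f g : E} (hfg : f ≠ g) (c : Γ.EnhancedState b →₀ ℝ) :
    addEdge ord f (addEdge ord g c) = - addEdge ord g (addEdge ord f c) := by
  suffices h : addEdge ord f ∘ₗ addEdge ord g =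
      - (addEdge (Γ := Γ) (b := b) ord g ∘ₗ addEdge ord f) from LinearMap.congr_fun h c
  refine Finsupp.lhom_ext' fun S => LinearMap.ext_ring ?_
  simp only [LinearMap.comp_apply, Finsupp.lsingle_apply, LinearMap.neg_apply]
  have aux : ∀ {f g : E}, f ≠ g → f ∈ S.edges →
      addEdge ord f (addEdge ord g (Finsupp.single S 1)) = 0 := by
    intro f g hfg hf
    rw [addEdge_single]
    split_ifs with hg
    · simp
    · rcases S.push_eq_zero_or (insert g S.edges) with h | ⟨S', h1, -, h⟩
      · rw [h]; simp
      · rw [h, map_smul, addEdge_single_of_mem ord (h1 ▸ Set.mem_insert_of_mem g hf), smul_zero]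
  by_cases hf : f ∈ S.edges
  · rw [aux hfg hf, addEdge_single_of_mem ord hf]; simp
  by_cases hg : g ∈ S.edges
  · rw [aux hfg.symm hg, addEdge_single_of_mem ord hg]; simp
  rw [addEdge_single_of_notMem ord hf, addEdge_single_of_notMem ord hg, map_smul, map_smul,
    addEdge_push ord (Set.subset_insert _ _) (by simp [hfg, hf]),
    addEdge_push ord (Set.subset_insert _ _) (by simp [hfg.symm, hg]), smul_smul, smul_smul,
    edgeSign_swap ord hfg hf hg, Set.insert_comm, neg_smul]

lemma addEdge_self (f : E) (c : Γ.EnhancedState b →₀ ℝ) : addEdge ord f (addEdge ord f c) = 0 := by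
  suffices h : addEdge ord f ∘ₗ addEdge (Γ := Γ) (b := b) ord f = 0 from LinearMap.congr_fun h c
  refine Finsupp.lhom_ext' fun S => LinearMap.ext_ring ?_
  simp only [LinearMap.comp_apply, Finsupp.lsingle_apply, LinearMap.zero_apply]
  rw [addEdge_single]
  split_ifs with hf
  · simp
  · rcases S.push_eq_zero_or (insert f S.edges) with h | ⟨S', h1, -, h⟩
    · rw [h]; simp
    · rw [h, map_smul, addEdge_single_of_mem ord (h1 ▸ Set.mem_insert f _), smul_zero]

/-- The part of the differential that adds edges of `T`. -/
noncomputable def addEdges (T : Finset E) :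
    (Γ.EnhancedState b →₀ ℝ) →ₗ[ℝ] (Γ.EnhancedState b →₀ ℝ) :=
  ∑ f ∈ T, addEdge ord f

lemma addEdges_apply (T : Finset E) (c : Γ.EnhancedState b →₀ ℝ) :
    addEdges ord T c = ∑ f ∈ T, addEdge ord f c := by
  simp [addEdges]

lemma addEdges_eq_add_erase {T : Finset E} {f : E} (hf : f ∈ T) (c : Γ.EnhancedState b →₀ ℝ) :
    addEdges ord T c = addEdge ord f c + addEdges ord (T.erase f) c := by
  rw [addEdges_apply, addEdges_apply, Finset.add_sum_erase T (fun g => addEdge ord g c) hf]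

lemma addEdges_anticomm [Finite E] {f : E} {T : Finset E} (hf : f ∉ T) (c : Γ.EnhancedState b →₀ ℝ) :
    addEdges ord T (addEdge ord f c) = - addEdge ord f (addEdges ord T c) := by
  rw [addEdges_apply, addEdges_apply, map_sum, ← Finset.sum_neg_distrib]
  exact Finset.sum_congr rfl fun g hg => addEdge_anticomm ord (ne_of_mem_of_not_mem hg hf) c

lemma addEdges_addEdges [Finite E] (T : Finset E) (c : Γ.EnhancedState b →₀ ℝ) :
    addEdges ord T (addEdges ord T c) = 0 := by
  induction T using Finset.induction_on with
  | empty => simp [addEdges]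
  | insert f T hf ih =>
    have h : ∀ c : Γ.EnhancedState b →₀ ℝ,
        addEdges ord (insert f T) c = addEdge ord f c + addEdges ord T c := fun c => by
      rw [addEdges_apply, addEdges_apply, Finset.sum_insert hf]
    rw [h, h, map_add, map_add, addEdge_self, ih, addEdges_anticomm ord hf]
    abel

end Operators

/-! ### Removing an edge at the base component: detaching and erasing -/

section Detach

open Classical

variable {V E : Type*} {Γ : IncidenceGraph V E} {b : V}

namespace EnhancedState

/-- The state `S` without the edge `f`, where all vertices keep their colours. -/
def eraseEdge (f : E) (S : Γ.EnhancedState b) : Γ.EnhancedState b where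
  edges := S.edges \ {f}
  colour := S.colour
  colour_eq u v h := S.colour_eq u v (reachable_mono Set.sdiff_subset h)
  colour_base := S.colour_base

/-- The state `S` without the edge `f`, where the component of `c` gets the colour `1`, unless it
is the component of the base point. -/
noncomputable def detach (f : E) (c : V) (S : Γ.EnhancedState b) : Γ.EnhancedState b where
  edges := S.edges \ {f}
  colour v := if (Γ.state (S.edges \ {f})).Reachable c v ∧
    ¬ (Γ.state (S.edges \ {f})).Reachable c b then Colour.one else S.colour v
  colour_eq u v h := by
    have h1 : (Γ.state (S.edges \ {f})).Reachable c u ↔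
        (Γ.state (S.edges \ {f})).Reachable c v := ⟨fun h' => h'.trans h, fun h' => h'.trans h.symm⟩
    rw [h1, S.colour_eq u v (reachable_mono Set.sdiff_subset h)]
  colour_base := by
    rw [if_neg (fun h => h.2 h.1), S.colour_base]

lemma detach_colour_iff (f : E) (c : V) (S : Γ.EnhancedState b) (v : V) :
    (S.detach f c).colour v = Colour.x ↔ S.colour v = Colour.x ∧
      ((Γ.state (S.edges \ {f})).Reachable c v → (Γ.state (S.edges \ {f})).Reachable c b) := by
  simp only [detach]
  split_ifs with h
  · simp [h.1, h.2]
  · refine ⟨fun hx => ⟨hx, fun hv => ?_⟩, fun h => h.1⟩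
    by_contra hb
    exact h ⟨hv, hb⟩

lemma insert_sdiff_of_mem {f : E} {s : Set E} (hf : f ∈ s) : insert f (s \ {f}) = s := by
  rw [Set.insert_sdiff_singleton, Set.insert_eq_of_mem hf]

lemma reachable_of_mem {s : Set E} {f : E} {a c : V} (hac : Γ.ends f = s(a, c)) (hf : f ∈ s)
    {u v : V} : (Γ.state s).Reachable u v ↔ (Γ.state (s \ {f})).Reachable u v ∨
      ((Γ.state (s \ {f})).Reachable u a ∧ (Γ.state (s \ {f})).Reachable c v) ∨
      ((Γ.state (s \ {f})).Reachable u c ∧ (Γ.state (s \ {f})).Reachable a v) := by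
  rw [← reachable_insert hac, insert_sdiff_of_mem hf]

/-- The end `a` lies in the base component, coloured `x`, and the colour to multiply with it to get
back `x` is `1`. If `c` also lies in the base component without `f`, no components merge and nothing
needs recolouring. -/
lemma detach_specializes {f : E} {a c : V} (hac : Γ.ends f = s(a, c))
    {S : Γ.EnhancedState b} (hf : f ∈ S.edges)
    (hab : (Γ.state (S.edges \ {f})).Reachable a b) : (S.detach f c).Specializes S where
  subset := Set.sdiff_subset
  colour_iff v := by
    constructor
    · intro hv
      by_cases h : (S.detach f c).colour v = Colour.x
      · exact ⟨v, h, SimpleGraph.Reachable.refl v⟩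
      · rw [detach_colour_iff] at h
        have hcv : (Γ.state (S.edges \ {f})).Reachable c v := by
          by_contra hcv
          exact h ⟨hv, fun h => absurd h hcv⟩
        refine ⟨b, colour_base _, ?_⟩
        exact (reachable_of_mem hac hf).2 (Or.inr (Or.inl ⟨hab.symm, hcv⟩))
    · rintro ⟨u, hu, huv⟩
      exact colour_x_of_reachable ((detach_colour_iff f c S u).1 hu).1 huv
  separated u v hu hv huv := by
    rw [detach_colour_iff] at hu hv
    rcases (reachable_of_mem hac hf).1 huv with h | ⟨h1, h2⟩ | ⟨h1, h2⟩
    · exact h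
    · exact ((h1.trans hab).trans (hv.2 h2).symm).trans h2
    · exact ((h1.trans (hu.2 h1.symm)).trans hab.symm).trans h2

lemma detach_eq_of_specializes {f : E} {a c : V} (hac : Γ.ends f = s(a, c))
    {S S' : Γ.EnhancedState b} (hf : f ∉ S.edges)
    (hab : (Γ.state S.edges).Reachable a b)
    (hc : S.colour c = Colour.x → (Γ.state S.edges).Reachable c b)
    (h : S.Specializes S') (he : S'.edges = insert f S.edges) : S'.detach f c = S := by
  have hs : S'.edges \ {f} = S.edges := by rw [he]; simp [hf]
  refine ext_of_colour_iff hs fun v => ?_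
  rw [detach_colour_iff, hs, h.colour_iff, he]
  constructor
  · rintro ⟨⟨w, hw, hwv⟩, hb⟩
    rcases (reachable_insert hac).1 hwv with h | ⟨h1, h2⟩ | ⟨h1, h2⟩
    · exact colour_x_of_reachable hw h
    · exact colour_x_of_reachable S.colour_base ((hb h2).symm.trans h2)
    · exact colour_x_of_reachable S.colour_base (hab.symm.trans h2)
  · exact fun hv => ⟨⟨v, hv, SimpleGraph.Reachable.refl v⟩,
      fun h => hc (colour_x_of_reachable hv h.symm)⟩

lemma specializes_saturate_insert {f : E} {a c : V} (hac : Γ.ends f = s(a, c))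
    {S : Γ.EnhancedState b}
    (hab : (Γ.state S.edges).Reachable a b)
    (hc : S.colour c = Colour.x → (Γ.state S.edges).Reachable c b) :
    S.Specializes (S.saturate (insert f S.edges)) := by
  refine specializes_saturate (Set.subset_insert _ _) fun u v hu hv huv => ?_
  rcases (reachable_insert hac).1 huv with h | ⟨h1, h2⟩ | ⟨h1, h2⟩
  · exact h
  · exact ((h1.trans hab).trans (hc (colour_x_of_reachable hv h2.symm)).symm).trans h2
  · exact ((h1.trans (hc (colour_x_of_reachable hu h1))).trans hab.symm).trans h2

lemma push_insert_eq_zero {f : E} {a c : V} (hac : Γ.ends f = s(a, c))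
    {S : Γ.EnhancedState b}
    (ha : S.colour a = Colour.x) (hc : S.colour c = Colour.x)
    (hn : ¬ (Γ.state S.edges).Reachable a c) : S.push (insert f S.edges) = 0 :=
  push_eq_zero fun _ hS' h => hn <| h.separated a c ha hc <|
    reachable_of_ends (hS'.symm ▸ Set.mem_insert f _) hac

lemma saturate_insert_colour {f : E} {a c : V} (hac : Γ.ends f = s(a, c))
    {S : Γ.EnhancedState b} (ha : S.colour a = Colour.x)
    (hc : S.colour c = Colour.x) : (S.saturate (insert f S.edges)).colour = S.colour := by
  refine funext fun v => colour_ext ?_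
  rw [saturate_colour_iff]
  constructor
  · rintro ⟨u, hu, huv⟩
    rcases (reachable_insert hac).1 huv with h | ⟨-, h⟩ | ⟨-, h⟩
    · exact colour_x_of_reachable hu h
    · exact colour_x_of_reachable hc h
    · exact colour_x_of_reachable ha h
  · exact fun h => ⟨v, h, SimpleGraph.Reachable.refl v⟩

/-- Erasing a bridge `f`, both ends of which are coloured `x`, commutes with adding edges. -/
lemma eraseEdge_specializes_iff {f : E} {a c : V} (hac : Γ.ends f = s(a, c))
    {S S' : Γ.EnhancedState b} (hf : f ∈ S.edges)
    (hS : S.edges ⊆ S'.edges) (hab : (Γ.state (S.edges \ {f})).Reachable a b)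
    (hcb : ¬ (Γ.state (S'.edges \ {f})).Reachable c b) :
    (S.eraseEdge f).Specializes (S'.eraseEdge f) ↔ S.Specializes S' := by
  have hf' := hS hf
  have hsub : S.edges \ {f} ⊆ S'.edges \ {f} := Set.sdiff_subset_sdiff_left hS
  have hxa : S.colour a = Colour.x :=
    colour_x_of_reachable S.colour_base (reachable_mono Set.sdiff_subset hab.symm)
  have hxc : S.colour c = Colour.x := colour_x_of_reachable hxa (reachable_of_ends hf hac)
  -- Both ends of `f` are coloured `x`, so a vertex that is reached through `f` is also reached from
  -- one of these ends without `f`.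
  have hcol : ∀ v, (∃ u, S.colour u = Colour.x ∧ (Γ.state S'.edges).Reachable u v) ↔
      ∃ u, S.colour u = Colour.x ∧ (Γ.state (S'.edges \ {f})).Reachable u v := by
    intro v
    constructor
    · rintro ⟨u, hu, huv⟩
      rcases (reachable_of_mem hac hf').1 huv with h | ⟨-, h⟩ | ⟨-, h⟩
      · exact ⟨u, hu, h⟩
      · exact ⟨c, hxc, h⟩
      · exact ⟨a, hxa, h⟩
    · rintro ⟨u, hu, huv⟩
      exact ⟨u, hu, reachable_mono Set.sdiff_subset huv⟩
  constructor
  · intro h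
    refine ⟨hS, fun v => (h.colour_iff v).trans (hcol v).symm, fun u v hu hv huv => ?_⟩
    refine (reachable_of_mem hac hf).2 ?_
    rcases (reachable_of_mem hac hf').1 huv with h' | ⟨h1, h2⟩ | ⟨h1, h2⟩
    · exact Or.inl (h.separated u v hu hv h')
    · exact Or.inr (Or.inl ⟨h.separated u a hu hxa h1, h.separated c v hxc hv h2⟩)
    · exact Or.inr (Or.inr ⟨h.separated u c hu hxc h1, h.separated a v hxa hv h2⟩)
  · intro h
    refine ⟨hsub, fun v => (h.colour_iff v).trans (hcol v), fun u v hu hv huv => ?_⟩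
    rcases (reachable_of_mem hac hf).1
      (h.separated u v hu hv (reachable_mono Set.sdiff_subset huv)) with h' | ⟨h1, h2⟩ | ⟨h1, h2⟩
    · exact h'
    · exact absurd (((reachable_mono hsub h2).trans (SimpleGraph.Reachable.symm huv)).trans
        (reachable_mono hsub (h1.trans hab))) hcb
    · exact absurd (((reachable_mono hsub h1.symm).trans huv).trans
        (reachable_mono hsub (h2.symm.trans hab))) hcb

lemma degree_eq (S : Γ.EnhancedState b) : S.degree =
    (((Γ.state S.edges).connectedComponentMk '' {v | S.colour v = Colour.x}).ncard : ℤ) - 1 := by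
  have : {K : (Γ.state S.edges).ConnectedComponent | ∃ v ∈ K.supp, S.colour v = Colour.x} =
      (Γ.state S.edges).connectedComponentMk '' {v | S.colour v = Colour.x} := by
    ext K
    exact ⟨fun ⟨v, hv, h⟩ => ⟨v, h, hv⟩, fun ⟨v, hv, h⟩ => ⟨v, h, hv⟩⟩
  rw [degree, this]

/-- Components coloured `x` correspond bijectively: `colour_iff` gives surjectivity and `separated`
injectivity. This is why the differential preserves the degree. -/
lemma Specializes.degree_eq {S S' : Γ.EnhancedState b} (h : S.Specializes S') :
    S'.degree = S.degree := by
  rw [EnhancedState.degree_eq, EnhancedState.degree_eq]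
  congr 2
  let φ : (Γ.state S.edges).ConnectedComponent → (Γ.state S'.edges).ConnectedComponent :=
    SimpleGraph.ConnectedComponent.map
      (SimpleGraph.Hom.ofLE (SimpleGraph.fromEdgeSet_mono (Set.image_mono h.subset)))
  have himg : (Γ.state S'.edges).connectedComponentMk '' {v | S'.colour v = Colour.x} =
      φ '' ((Γ.state S.edges).connectedComponentMk '' {v | S.colour v = Colour.x}) := by
    ext K
    constructor
    · rintro ⟨v, hv, rfl⟩
      obtain ⟨u, hu, huv⟩ := (h.colour_iff v).1 hv
      exact ⟨_, ⟨u, hu, rfl⟩, SimpleGraph.ConnectedComponent.sound huv⟩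
    · rintro ⟨_, ⟨u, hu, rfl⟩, rfl⟩
      exact ⟨u, (h.colour_iff u).2 ⟨u, hu, SimpleGraph.Reachable.refl u⟩, rfl⟩
  rw [himg, Set.InjOn.ncard_image]
  rintro _ ⟨u, hu, rfl⟩ _ ⟨v, hv, rfl⟩ huv
  exact SimpleGraph.ConnectedComponent.sound
    (h.separated u v hu hv (SimpleGraph.ConnectedComponent.exact huv))

/-- Detaching preserves the degree, and erasing differs from it only in the component of `c`, which
keeps the colour `x` instead of receiving `1`. -/
lemma degree_eraseEdge [Finite V] {f : E} {a c : V} (hac : Γ.ends f = s(a, c))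
    {S : Γ.EnhancedState b} (hf : f ∈ S.edges)
    (hab : (Γ.state (S.edges \ {f})).Reachable a b)
    (hcb : ¬ (Γ.state (S.edges \ {f})).Reachable c b) :
    (S.eraseEdge f).degree = S.degree + 1 := by
  have hxc : S.colour c = Colour.x := colour_x_of_reachable S.colour_base
    ((reachable_mono Set.sdiff_subset hab.symm).trans (reachable_of_ends hf hac))
  rw [(detach_specializes hac hf hab).degree_eq, EnhancedState.degree_eq,
    EnhancedState.degree_eq]
  change (((Γ.state (S.edges \ {f})).connectedComponentMk '' {v | S.colour v = Colour.x}).ncard : ℤ)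
    - 1 = (((Γ.state (S.edges \ {f})).connectedComponentMk ''
      {v | (S.detach f c).colour v = Colour.x}).ncard : ℤ) - 1 + 1
  have : (Γ.state (S.edges \ {f})).connectedComponentMk '' {v | S.colour v = Colour.x} =
      insert ((Γ.state (S.edges \ {f})).connectedComponentMk c)
      ((Γ.state (S.edges \ {f})).connectedComponentMk ''
        {v | (S.detach f c).colour v = Colour.x}) := by
    ext K
    constructor
    · rintro ⟨v, hv, rfl⟩
      by_cases h : (Γ.state (S.edges \ {f})).Reachable c v
      · exact Or.inl (SimpleGraph.ConnectedComponent.sound h.symm)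
      · exact Or.inr ⟨v, (detach_colour_iff f c S v).2 ⟨hv, fun h' => absurd h' h⟩, rfl⟩
    · rintro (rfl | ⟨v, hv, rfl⟩)
      · exact ⟨c, hxc, rfl⟩
      · exact ⟨v, ((detach_colour_iff f c S v).1 hv).1, rfl⟩
  rw [this, Set.ncard_insert_of_notMem _ (Set.toFinite _)]
  · push_cast; ring
  · rintro ⟨v, hv, hvc⟩
    exact hcb (((detach_colour_iff f c S v).1 hv).2
      (SimpleGraph.ConnectedComponent.exact hvc).symm)

end EnhancedState

end Detach

/-! ### Operators that invert the addition of one edge -/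

section Exactness

open Classical EnhancedState

variable {V E : Type*} {Γ : IncidenceGraph V E} {b : V}

/-- The section of `addEdge ord f` that detaches the component of `c`. -/
noncomputable def detachOp (ord : EdgeOrder E) (f : E) (c : V) :
    (Γ.EnhancedState b →₀ ℝ) →ₗ[ℝ] (Γ.EnhancedState b →₀ ℝ) :=
  Finsupp.linearCombination ℝ fun S =>
    if f ∈ S.edges then edgeSign ord f (S.edges \ {f}) • Finsupp.single (S.detach f c) 1 else 0

/-- The signed linear extension of `eraseEdge`. -/
noncomputable def eraseOp (ord : EdgeOrder E) (f : E) :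
    (Γ.EnhancedState b →₀ ℝ) →ₗ[ℝ] (Γ.EnhancedState b →₀ ℝ) :=
  Finsupp.linearCombination ℝ fun S =>
    if f ∈ S.edges then edgeSign ord f (S.edges \ {f}) • Finsupp.single (S.eraseEdge f) 1 else 0

/-- The inverse of `eraseOp ord f` on states in which the end points of `f` are coloured `x`. -/
noncomputable def attachOp (ord : EdgeOrder E) (f : E) :
    (Γ.EnhancedState b →₀ ℝ) →ₗ[ℝ] (Γ.EnhancedState b →₀ ℝ) :=
  Finsupp.linearCombination ℝ fun S =>
    edgeSign ord f S.edges • Finsupp.single (S.saturate (insert f S.edges)) 1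

variable (ord : EdgeOrder E)

lemma detachOp_single {f : E} {S : Γ.EnhancedState b} (hf : f ∈ S.edges) (c : V) :
    detachOp ord f c (Finsupp.single S 1) =
      edgeSign ord f (S.edges \ {f}) • Finsupp.single (S.detach f c) 1 := by
  rw [detachOp, Finsupp.linearCombination_single, one_smul, if_pos hf]

lemma eraseOp_single {f : E} {S : Γ.EnhancedState b} (hf : f ∈ S.edges) :
    eraseOp ord f (Finsupp.single S 1) =
      edgeSign ord f (S.edges \ {f}) • Finsupp.single (S.eraseEdge f) 1 := by
  rw [eraseOp, Finsupp.linearCombination_single, one_smul, if_pos hf]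

lemma attachOp_single (f : E) (S : Γ.EnhancedState b) :
    attachOp ord f (Finsupp.single S 1) =
      edgeSign ord f S.edges • Finsupp.single (S.saturate (insert f S.edges)) 1 := by
  rw [attachOp, Finsupp.linearCombination_single, one_smul]

section

variable {f : E} {a c : V}

lemma addEdge_detachOp (hac : Γ.ends f = s(a, c)) {S : Γ.EnhancedState b} (hf : f ∈ S.edges)
    (hab : (Γ.state (S.edges \ {f})).Reachable a b) :
    addEdge ord f (detachOp ord f c (Finsupp.single S 1)) = Finsupp.single S 1 := by
  have hn : f ∉ (S.detach f c).edges := fun h => h.2 rfl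
  rw [detachOp_single ord hf, map_smul, addEdge_single_of_notMem ord hn,
    (detach_specializes hac hf hab).push_eq
      (t := insert f (S.detach f c).edges) (insert_sdiff_of_mem hf).symm, smul_smul]
  exact (congrArg (· • _) (edgeSign_mul_self ord f _)).trans (one_smul _ _)

/-- The component of `c` is coloured `1` or is that of `b`, so adding `f` loses no information. The
remaining states without `f` are those of `addEdge_eq_zero`. -/
lemma detachOp_addEdge (hac : Γ.ends f = s(a, c)) {S : Γ.EnhancedState b} (hf : f ∉ S.edges)
    (hab : (Γ.state S.edges).Reachable a b)
    (hc : S.colour c = Colour.x → (Γ.state S.edges).Reachable c b) :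
    detachOp ord f c (addEdge ord f (Finsupp.single S 1)) = Finsupp.single S 1 := by
  have h := specializes_saturate_insert hac hab hc
  have hs : (S.saturate (insert f S.edges)).edges \ {f} = S.edges := by
    change insert f S.edges \ {f} = S.edges
    simp [hf]
  rw [addEdge_single_of_notMem ord hf, h.push_eq (t := insert f S.edges) rfl, map_smul,
    detachOp_single ord (Set.mem_insert f S.edges), detach_eq_of_specializes hac hf hab hc h rfl,
    hs, smul_smul, edgeSign_mul_self, one_smul]

lemma addEdge_eq_zero (hac : Γ.ends f = s(a, c)) {S : Γ.EnhancedState b}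
    (hab : (Γ.state S.edges).Reachable a b) (hc : S.colour c = Colour.x)
    (hcb : ¬ (Γ.state S.edges).Reachable c b) : addEdge ord f (Finsupp.single S 1) = 0 := by
  rw [addEdge_single]
  split_ifs
  · rfl
  · rw [push_insert_eq_zero hac (colour_x_of_reachable S.colour_base hab.symm) hc
      (fun h => hcb (h.symm.trans hab)), smul_zero]

lemma eraseOp_attachOp (hac : Γ.ends f = s(a, c)) {S : Γ.EnhancedState b} (hf : f ∉ S.edges)
    (ha : S.colour a = Colour.x) (hc : S.colour c = Colour.x) :
    eraseOp ord f (attachOp ord f (Finsupp.single S 1)) = Finsupp.single S 1 := by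
  have hs : insert f S.edges \ {f} = S.edges := by simp [hf]
  have he : (S.saturate (insert f S.edges)).eraseEdge f = S :=
    EnhancedState.ext hs (saturate_insert_colour hac ha hc)
  have hs' : (S.saturate (insert f S.edges)).edges \ {f} = S.edges := hs
  rw [attachOp_single, map_smul, eraseOp_single ord (Set.mem_insert f S.edges), he, hs',
    smul_smul, edgeSign_mul_self, one_smul]

lemma attachOp_eraseOp (hac : Γ.ends f = s(a, c)) {S : Γ.EnhancedState b} (hf : f ∈ S.edges)
    (ha : S.colour a = Colour.x) :
    attachOp ord f (eraseOp ord f (Finsupp.single S 1)) = Finsupp.single S 1 := by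
  have hc : S.colour c = Colour.x := colour_x_of_reachable ha (reachable_of_ends hf hac)
  have he : (S.eraseEdge f).saturate (insert f (S.eraseEdge f).edges) = S :=
    EnhancedState.ext (insert_sdiff_of_mem hf)
      (saturate_insert_colour hac (S := S.eraseEdge f) ha hc)
  rw [eraseOp_single ord hf, map_smul, attachOp_single, he, smul_smul]
  exact (congrArg (· • _) (edgeSign_mul_self ord f _)).trans (one_smul _ _)

/-- Since `f` is still a bridge after `g` is added, its presence does not affect whether adding `g`
joins two components coloured `x` in a forbidden way. Thus `eraseOp` commutes with the differential
up to a sign, although it changes the degree. -/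
lemma addEdge_eraseOp [Finite E] (hac : Γ.ends f = s(a, c)) {g : E} (hgf : g ≠ f)
    {S : Γ.EnhancedState b} (hf : f ∈ S.edges) (hab : (Γ.state (S.edges \ {f})).Reachable a b)
    (hcb : ¬ (Γ.state (insert g S.edges \ {f})).Reachable c b) :
    addEdge ord g (eraseOp ord f (Finsupp.single S 1)) =
      - eraseOp ord f (addEdge ord g (Finsupp.single S 1)) := by
  rw [eraseOp_single ord hf, map_smul]
  by_cases hg : g ∈ S.edges
  · rw [addEdge_single_of_mem ord hg, addEdge_single_of_mem ord (S := S.eraseEdge f) ⟨hg, hgf⟩]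
    simp
  have hg' : g ∉ (S.eraseEdge f).edges := fun h => hg h.1
  have hins : insert g (S.edges \ {f}) = insert g S.edges \ {f} :=
    (Set.insert_sdiff_singleton_comm hgf _).symm ▸ rfl
  rw [addEdge_single_of_notMem ord hg, addEdge_single_of_notMem ord hg', map_smul]
  have hsgn := edgeSign_swap ord hgf.symm (s := S.edges \ {f}) (fun h => h.2 rfl) hg'
  rw [insert_sdiff_of_mem hf, hins] at hsgn
  have hpush : eraseOp ord f (S.push (insert g S.edges)) =
      edgeSign ord f (insert g S.edges \ {f}) •
        (S.eraseEdge f).push (insert g (S.eraseEdge f).edges) := by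
    rcases S.push_eq_zero_or (insert g S.edges) with h0 | ⟨S', h1, h2, h3⟩
    · rw [h0, map_zero, push_eq_zero, smul_zero]
      intro S'' hS'' hsp
      -- A specialization of the erased state would be the erasure of its own reattachment; then `S`
      -- itself would specialize to that reattachment, contrary to `h0`.
      have hfac : (S''.saturate (insert f S''.edges)).eraseEdge f = S'' := by
        have hfn : f ∉ S''.edges := by
          rw [hS'']
          rintro (h | h)
          · exact hgf h.symm
          · exact h.2 rfl
        have hxa : S''.colour a = Colour.x :=
          colour_x_of_reachable S''.colour_base (reachable_mono hsp.subset hab.symm)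
        have hxc : S''.colour c = Colour.x := (hsp.colour_iff c).2
          ⟨c, colour_x_of_reachable (S := S) S.colour_base ((reachable_mono Set.sdiff_subset hab.symm).trans
            (reachable_of_ends hf hac)), SimpleGraph.Reachable.refl c⟩
        refine EnhancedState.ext ?_ (saturate_insert_colour hac hxa hxc)
        change insert f S''.edges \ {f} = S''.edges
        simp [hfn]
      have hedges : insert f S''.edges = insert g S.edges := by
        rw [hS'', Set.insert_comm]
        exact congrArg (insert g) (insert_sdiff_of_mem hf)
      rw [← hfac, eraseEdge_specializes_iff hac hf (by
        change S.edges ⊆ insert f S''.edges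
        rw [hedges]; exact Set.subset_insert _ _) hab (by
        change ¬ (Γ.state (insert f S''.edges \ {f})).Reachable c b
        rwa [hedges])] at hsp
      rw [hsp.push_eq (t := insert g S.edges) hedges] at h0
      exact one_ne_zero (Finsupp.single_eq_zero.1 h0)
    · have hf' : f ∈ S'.edges := h1 ▸ Set.mem_insert_of_mem g hf
      rw [h3, eraseOp_single ord hf', h1, ((eraseEdge_specializes_iff hac hf h2.subset hab
        (by rwa [h1])).2 h2).push_eq (t := insert g (S.eraseEdge f).edges)]
      change S'.edges \ {f} = insert g (S.edges \ {f})
      rw [h1, hins]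
  rw [hpush, smul_smul, smul_smul, ← neg_smul]
  congr 1
  have h1 := edgeSign_mul_self ord f (S.edges \ {f})
  have h2 := edgeSign_mul_self ord f (insert g S.edges \ {f})
  change edgeSign ord f (S.edges \ {f}) * edgeSign ord g (S.edges \ {f}) = _
  -- The signs have square `1`, so `hsgn` may be multiplied by the two signs of `f` to carry them
  -- across.
  linear_combination edgeSign ord f (S.edges \ {f}) * edgeSign ord f (insert g S.edges \ {f}) * hsgn
    - edgeSign ord f (S.edges \ {f}) * edgeSign ord g (S.edges \ {f}) * h2
    - edgeSign ord g S.edges * edgeSign ord f (insert g S.edges \ {f}) * h1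

end

end Exactness

/-! ### Minors as intervals of edge sets, and concentration on one diagonal -/

section Exactness

open Classical EnhancedState

variable {V E : Type*} {Γ : IncidenceGraph V E} {b : V}

/-- The enhanced states of dimension `i` and degree `j` with edge set between `A` and `T`. -/
def intervalStates (Γ : IncidenceGraph V E) (b : V) (A T : Finset E) (i j : ℤ) :
    Set (Γ.EnhancedState b) :=
  {S | (A : Set E) ⊆ S.edges ∧ S.edges ⊆ T ∧ S.dimension = i ∧ S.degree = j}

/-- The cochains of the minor of `Γ` in which the edges of `A` are contracted and those outside
`T` are removed, without a shift of degrees. -/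
noncomputable def intervalChains (Γ : IncidenceGraph V E) (b : V) (A T : Finset E) (i j : ℤ) :
    Submodule ℝ (Γ.EnhancedState b →₀ ℝ) :=
  Finsupp.supported ℝ ℝ (Γ.intervalStates b A T i j)

lemma intervalChains_mono {A A' T T' : Finset E} (hA : A' ⊆ A) (hT : T ⊆ T') (i j : ℤ) :
    Γ.intervalChains b A T i j ≤ Γ.intervalChains b A' T' i j :=
  Finsupp.supported_mono fun _ hS =>
    ⟨(Finset.coe_subset.2 hA).trans hS.1, hS.2.1.trans (Finset.coe_subset.2 hT), hS.2.2⟩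

variable (ord : EdgeOrder E)

lemma dimension_of_insert [Finite E] {f : E} {S S' : Γ.EnhancedState b} (hf : f ∉ S.edges)
    (h : S'.edges = insert f S.edges) : S'.dimension = S.dimension + 1 := by
  rw [dimension, dimension, h, Set.ncard_insert_of_notMem hf (Set.toFinite _)]
  push_cast; ring

/-- The lower bound `insert f A` records that the `f`-part of the differential lands in the
subcomplex of states that contain `f`. -/
lemma addEdge_mem [Finite E] {A T : Finset E} {f : E} (hf : f ∈ T) {i j : ℤ}
    {c : Γ.EnhancedState b →₀ ℝ} (hc : c ∈ Γ.intervalChains b A T i j) :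
    addEdge ord f c ∈ Γ.intervalChains b (insert f A) T (i + 1) j := by
  refine linearMap_mem_of_supported (fun S hS => ?_) hc
  rw [addEdge_single]
  split_ifs with hfS
  · exact Submodule.zero_mem _
  · refine Submodule.smul_mem _ _ ?_
    rcases S.push_eq_zero_or (insert f S.edges) with h | ⟨S', h1, h2, h⟩
    · rw [h]; exact Submodule.zero_mem _
    · rw [h]
      refine Finsupp.single_mem_supported ℝ 1 ⟨?_, ?_, ?_, ?_⟩
      · rw [h1, Finset.coe_insert]
        exact Set.insert_subset_insert hS.1
      · rw [h1]
        exact Set.insert_subset hf hS.2.1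
      · rw [dimension_of_insert hfS h1, hS.2.2.1]
      · rw [h2.degree_eq, hS.2.2.2]

lemma addEdges_mem [Finite E] {A T T' : Finset E} (hT : T' ⊆ T) {i j : ℤ}
    {c : Γ.EnhancedState b →₀ ℝ} (hc : c ∈ Γ.intervalChains b A T i j) :
    addEdges ord T' c ∈ Γ.intervalChains b A T (i + 1) j := by
  rw [addEdges_apply]
  exact Submodule.sum_mem _ fun f hf =>
    intervalChains_mono (Finset.subset_insert f A) subset_rfl _ _ (addEdge_mem ord (hT hf) hc)

lemma exists_add_of_mem {A T : Finset E} (f : E) {i j : ℤ}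
    {c : Γ.EnhancedState b →₀ ℝ} (hc : c ∈ Γ.intervalChains b A T i j) :
    ∃ c₁ ∈ Γ.intervalChains b (insert f A) T i j, ∃ c₀ ∈ Γ.intervalChains b A (T.erase f) i j,
      c = c₁ + c₀ := by
  refine ⟨c.filter (fun S => f ∈ S.edges), ?_, c.filter (fun S => f ∉ S.edges), ?_,
    (Finsupp.filter_add_filter_not _ _).symm⟩
  · intro S hS
    rw [Finset.mem_coe, Finsupp.support_filter, Finset.mem_filter] at hS
    obtain ⟨h1, h2⟩ := hc hS.1
    refine ⟨?_, h2⟩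
    rw [Finset.coe_insert]
    exact Set.insert_subset hS.2 h1
  · intro S hS
    rw [Finset.mem_coe, Finsupp.support_filter, Finset.mem_filter] at hS
    obtain ⟨h1, h2, h3⟩ := hc hS.1
    refine ⟨h1, ?_, h3⟩
    rw [Finset.coe_erase]
    exact Set.subset_sdiff_singleton h2 hS.2

lemma eq_zero_of_add_eq_zero {A T : Finset E} {f : E} {i j : ℤ}
    {c₁ c₀ : Γ.EnhancedState b →₀ ℝ} (h₁ : c₁ ∈ Γ.intervalChains b (insert f A) T i j)
    (h₀ : c₀ ∈ Γ.intervalChains b A (T.erase f) i j) (h : c₁ + c₀ = 0) : c₁ = 0 ∧ c₀ = 0 := by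
  have hdisj : Disjoint (Γ.intervalChains b (insert f A) T i j)
      (Γ.intervalChains b A (T.erase f) i j) := by
    refine Finsupp.disjoint_supported_supported (Set.disjoint_left.2 fun S hS hS' => ?_)
    have h1 : f ∈ S.edges := hS.1 (Finset.mem_coe.2 (Finset.mem_insert_self f A))
    have h2 := hS'.2.1 h1
    rw [Finset.coe_erase] at h2
    exact h2.2 rfl
  have h1 : c₁ = 0 := by
    refine Submodule.disjoint_def.1 hdisj c₁ h₁ ?_
    rw [eq_neg_of_add_eq_zero_left h]
    exact Submodule.neg_mem _ h₀
  refine ⟨h1, ?_⟩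
  rwa [h1, zero_add] at h

variable {ord} {f : E} {u v : V}

/-- The states without the edge `f` in which `v` lies in a component coloured `x` other than that
of the base point. -/
def detachedStates (Γ : IncidenceGraph V E) (b : V) (A T : Finset E) (f : E) (v : V) (i j : ℤ) :
    Set (Γ.EnhancedState b) :=
  {S | S ∈ Γ.intervalStates b A (T.erase f) i j ∧ S.colour v = Colour.x ∧
    ¬ (Γ.state S.edges).Reachable v b}

lemma notMem_of_subset_erase {T : Finset E} {s : Set E} (hs : s ⊆ (T.erase f : Finset E)) :
    f ∉ s := by
  intro h
  have := hs h
  rw [Finset.coe_erase] at this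
  exact this.2 rfl

lemma colour_x_of_subset {A : Finset E} (hub : (Γ.state A).Reachable u b)
    {S : Γ.EnhancedState b} (hS : (A : Set E) ⊆ S.edges) : S.colour u = Colour.x :=
  colour_x_of_reachable S.colour_base (reachable_mono hS hub.symm)

lemma addEdges_eq_addEdges_erase {A T : Finset E} (hfT : f ∈ T) {i j : ℤ}
    {y : Γ.EnhancedState b →₀ ℝ} (hy : y ∈ Γ.intervalChains b (insert f A) T i j) :
    addEdges ord T y = addEdges ord (T.erase f) y := by
  rw [addEdges_eq_add_erase ord hfT]
  have : addEdge ord f y = 0 := linearMap_eq_of_supported (L₂ := 0) (fun S hS =>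
    addEdge_single_of_mem ord (hS.1 (Finset.mem_coe.2 (Finset.mem_insert_self f A)))) hy
  rw [this, zero_add]

lemma addEdge_eq_zero_of_mem {A T : Finset E}
    (huv : Γ.ends f = s(u, v)) (hub : (Γ.state A).Reachable u b) {i j : ℤ}
    {z : Γ.EnhancedState b →₀ ℝ}
    (hz : z ∈ Finsupp.supported ℝ ℝ (Γ.detachedStates b A T f v i j)) : addEdge ord f z = 0 :=
  linearMap_eq_of_supported (L₂ := 0) (fun _ hS =>
    addEdge_eq_zero ord huv (reachable_mono hS.1.1 hub) hS.2.1 hS.2.2) hz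

lemma mem_of_mem_detached {A T : Finset E} {i j : ℤ} {z : Γ.EnhancedState b →₀ ℝ}
    (hz : z ∈ Finsupp.supported ℝ ℝ (Γ.detachedStates b A T f v i j)) :
    z ∈ Γ.intervalChains b A T i j :=
  intervalChains_mono subset_rfl (T.erase_subset f) _ _
    (Finsupp.supported_mono (fun _ h => h.1) hz)

lemma attachOp_eraseOp_of_mem {A T : Finset E}
    (huv : Γ.ends f = s(u, v)) (hub : (Γ.state A).Reachable u b) {i j : ℤ}
    {y : Γ.EnhancedState b →₀ ℝ} (hy : y ∈ Γ.intervalChains b (insert f A) T i j) :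
    attachOp ord f (eraseOp ord f y) = y := by
  refine linearMap_eq_of_supported (L₁ := attachOp ord f ∘ₗ eraseOp ord f)
    (L₂ := LinearMap.id) (fun S hS => ?_) hy
  have hS1 := hS.1
  rw [Finset.coe_insert, Set.insert_subset_iff] at hS1
  exact attachOp_eraseOp ord huv hS1.1 (colour_x_of_subset hub hS1.2)

lemma eraseOp_attachOp_of_mem {A T : Finset E}
    (huv : Γ.ends f = s(u, v)) (hub : (Γ.state A).Reachable u b) {i j : ℤ}
    {z : Γ.EnhancedState b →₀ ℝ}
    (hz : z ∈ Finsupp.supported ℝ ℝ (Γ.detachedStates b A T f v i j)) :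
    eraseOp ord f (attachOp ord f z) = z := by
  refine linearMap_eq_of_supported (L₁ := eraseOp ord f ∘ₗ attachOp ord f)
    (L₂ := LinearMap.id) (fun S hS => ?_) hz
  have hf : f ∉ S.edges := notMem_of_subset_erase hS.1.2.1
  have hx : S.colour u = Colour.x := colour_x_of_subset hub hS.1.1
  exact eraseOp_attachOp ord huv hf hx hS.2.1

/-- The complex of the minor given by `A` and `T` is exact in bidegree `(i, j)`. -/
def IsExactAt (Γ : IncidenceGraph V E) (b : V) (ord : EdgeOrder E) (A T : Finset E)
    (i j : ℤ) : Prop :=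
  ∀ c ∈ Γ.intervalChains b A T i j, addEdges ord T c = 0 →
    ∃ c' ∈ Γ.intervalChains b A T (i - 1) j, addEdges ord T c' = c

/-- The enhanced state in which all components are coloured `x`. -/
def allX (Γ : IncidenceGraph V E) (b : V) (s : Set E) : Γ.EnhancedState b where
  edges := s
  colour _ := Colour.x
  colour_eq _ _ _ := rfl
  colour_base := rfl

/-- Contracting `f` adds one edge and lowers this degree by one, so the diagonal of
`isExactAt_of_connected` does not move. -/
lemma degree_allX_insert [Finite V] {s : Set E} (hf : f ∉ s) (huv : Γ.ends f = s(u, v))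
    (hub : (Γ.state s).Reachable u b) (hvb : ¬ (Γ.state s).Reachable v b) :
    (Γ.allX b s).degree = (Γ.allX b (insert f s)).degree + 1 := by
  have hs : insert f s \ {f} = s := by simp [hf]
  have hs' : (Γ.allX b (insert f s)).edges \ {f} = s := hs
  have he : (Γ.allX b (insert f s)).eraseEdge f = Γ.allX b s := EnhancedState.ext hs rfl
  rw [← he]
  exact degree_eraseEdge huv (Set.mem_insert f s) (by rwa [hs']) (by rwa [hs'])

variable [Finite E]

/-- The diagram chase for the middle of a short exact sequence, with the contraction of `f` as
subcomplex and its deletion as quotient. -/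
lemma IsExactAt.of_erase_of_insert {A T : Finset E} (hfT : f ∈ T) {i j : ℤ}
    (h₀ : IsExactAt Γ b ord A (T.erase f) i j) (h₁ : IsExactAt Γ b ord (insert f A) T i j) :
    IsExactAt Γ b ord A T i j := by
  intro c hc hdc
  obtain ⟨c₁, hc₁, c₀, hc₀, rfl⟩ := exists_add_of_mem f hc
  have hd : addEdges ord (T.erase f) c₀ = 0 := by
    rw [map_add, addEdges_eq_add_erase ord hfT c₀, ← add_assoc] at hdc
    refine (eq_zero_of_add_eq_zero (Submodule.add_mem _ (addEdges_mem ord subset_rfl hc₁) ?_)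
      (addEdges_mem ord subset_rfl hc₀) hdc).2
    exact addEdge_mem ord hfT (intervalChains_mono subset_rfl (T.erase_subset f) _ _ hc₀)
  obtain ⟨b₀, hb₀, hdb₀⟩ := h₀ c₀ hc₀ hd
  have hb₀' := intervalChains_mono (Finset.Subset.refl A) (T.erase_subset f) _ _ hb₀
  -- Subtracting this coboundary removes the quotient part, so what remains is a cocycle of the
  -- subcomplex.
  have heq : c₁ + c₀ - addEdges ord T b₀ = c₁ - addEdge ord f b₀ := by
    rw [addEdges_eq_add_erase ord hfT, hdb₀]; abel
  have hmem := addEdge_mem ord hfT hb₀'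
  rw [sub_add_cancel] at hmem
  obtain ⟨b₁, hb₁, hdb₁⟩ := h₁ _ (Submodule.sub_mem _ hc₁ hmem) (by
    rw [← heq, map_sub, hdc, addEdges_addEdges, sub_zero])
  refine ⟨b₀ + b₁, Submodule.add_mem _ hb₀'
    (intervalChains_mono (Finset.subset_insert f A) subset_rfl _ _ hb₁), ?_⟩
  rw [map_add, hdb₁, ← heq]; abel

/-- Unlike the differential, attaching `f` merges two components coloured `x` into one, whence the
degree `j - 1`. -/
lemma attachOp_mem [Finite V] {A T : Finset E} (hfT : f ∈ T)
    (huv : Γ.ends f = s(u, v)) (hub : (Γ.state A).Reachable u b) {i j : ℤ}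
    {z : Γ.EnhancedState b →₀ ℝ}
    (hz : z ∈ Finsupp.supported ℝ ℝ (Γ.detachedStates b A T f v i j)) :
    attachOp ord f z ∈ Γ.intervalChains b (insert f A) T (i + 1) (j - 1) := by
  refine linearMap_mem_of_supported (fun S hS => ?_) hz
  obtain ⟨⟨h1, h2, h3, h4⟩, h5, h6⟩ := hS
  have hf := notMem_of_subset_erase h2
  rw [attachOp_single]
  refine Submodule.smul_mem _ _ (Finsupp.single_mem_supported ℝ 1 ⟨?_, ?_, ?_, ?_⟩)
  · rw [Finset.coe_insert]
    exact Set.insert_subset_insert h1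
  · rw [Finset.coe_erase] at h2
    exact Set.insert_subset hfT (h2.trans Set.sdiff_subset)
  · rw [dimension_of_insert (S := S) hf rfl, h3]
  · have hs : insert f S.edges \ {f} = S.edges := by simp [hf]
    have hs' : (S.saturate (insert f S.edges)).edges \ {f} = S.edges := hs
    have he : (S.saturate (insert f S.edges)).eraseEdge f = S :=
      EnhancedState.ext hs (saturate_insert_colour huv (colour_x_of_subset hub h1) h5)
    have := degree_eraseEdge huv (S := S.saturate (insert f S.edges)) (Set.mem_insert f _)
      (by rw [hs']; exact reachable_mono h1 hub) (by rwa [hs'])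
    rw [he, h4] at this
    rw [this]; ring

lemma eraseOp_mem [Finite V] {A T : Finset E} (hfA : f ∉ A)
    (huv : Γ.ends f = s(u, v)) (hub : (Γ.state A).Reachable u b)
    (hvb : ¬ (Γ.state (T.erase f)).Reachable v b) {i j : ℤ} {y : Γ.EnhancedState b →₀ ℝ}
    (hy : y ∈ Γ.intervalChains b (insert f A) T i j) :
    eraseOp ord f y ∈
      Finsupp.supported ℝ ℝ (Γ.detachedStates b A T f v (i - 1) (j + 1)) := by
  refine linearMap_mem_of_supported (fun S hS => ?_) hy
  obtain ⟨h1, h2, h3, h4⟩ := hS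
  rw [Finset.coe_insert, Set.insert_subset_iff] at h1
  have hA := Set.subset_sdiff_singleton h1.2 hfA
  have hT : S.edges \ {f} ⊆ (T.erase f : Finset E) := by
    rw [Finset.coe_erase]
    exact Set.sdiff_subset_sdiff_left h2
  have hn : ¬ (Γ.state (S.edges \ {f})).Reachable v b := fun hr => hvb (reachable_mono hT hr)
  rw [eraseOp_single ord h1.1]
  refine Submodule.smul_mem _ _ (Finsupp.single_mem_supported ℝ 1 ⟨⟨hA, hT, ?_, ?_⟩, ?_, hn⟩)
  · have := dimension_of_insert (f := f) (S := S.eraseEdge f) (S' := S) (fun h => h.2 rfl)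
      (insert_sdiff_of_mem h1.1).symm
    rw [h3] at this
    linarith
  · rw [degree_eraseEdge huv h1.1 (reachable_mono hA hub) hn, h4]
  · exact colour_x_of_reachable (S := S) (colour_x_of_subset hub h1.2)
      (reachable_of_ends h1.1 huv)

lemma addEdges_eraseOp {A T : Finset E} (hfA : f ∉ A)
    (huv : Γ.ends f = s(u, v)) (hub : (Γ.state A).Reachable u b)
    (hvb : ¬ (Γ.state (T.erase f)).Reachable v b) {i j : ℤ} {y : Γ.EnhancedState b →₀ ℝ}
    (hy : y ∈ Γ.intervalChains b (insert f A) T i j) :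
    addEdges ord (T.erase f) (eraseOp ord f y) =
      - eraseOp ord f (addEdges ord (T.erase f) y) := by
  rw [addEdges_apply, addEdges_apply, map_sum, ← Finset.sum_neg_distrib]
  refine Finset.sum_congr rfl fun g hg => ?_
  refine linearMap_eq_of_supported (L₁ := addEdge ord g ∘ₗ eraseOp ord f)
    (L₂ := - (eraseOp ord f ∘ₗ addEdge ord g)) (fun S hS => ?_) hy
  have hS1 := hS.1
  rw [Finset.coe_insert, Set.insert_subset_iff] at hS1
  refine addEdge_eraseOp ord huv (Finset.ne_of_mem_erase hg) hS1.1
    (reachable_mono (Set.subset_sdiff_singleton hS1.2 hfA) hub) fun hr => hvb ?_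
  refine reachable_mono ?_ hr
  rw [Finset.coe_erase]
  exact Set.sdiff_subset_sdiff_left (Set.insert_subset (Finset.mem_of_mem_erase hg) hS.2.1)

/-- If `f` has an end point `u` in the component of `b`, then each cocycle is cohomologous to one
that is supported on states without the edge `f` in which the other end point `v` of `f` lies in
another component, which is coloured `x`. -/
lemma exists_cohomologous {A T : Finset E} (hfT : f ∈ T) (hfA : f ∉ A)
    (huv : Γ.ends f = s(u, v)) (hub : (Γ.state A).Reachable u b) {i j : ℤ}
    {c : Γ.EnhancedState b →₀ ℝ} (hc : c ∈ Γ.intervalChains b A T i j)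
    (hdc : addEdges ord T c = 0) :
    ∃ c' ∈ Γ.intervalChains b A T (i - 1) j, c - addEdges ord T c' ∈
      Finsupp.supported ℝ ℝ (Γ.detachedStates b A T f v i j) := by
  obtain ⟨c₁, hc₁, c₀, hc₀, rfl⟩ := exists_add_of_mem f hc
  -- The part with `f` is the `f`-part of a coboundary, so it can be subtracted away.
  have hsec : addEdge ord f (detachOp ord f v c₁) = c₁ := by
    refine linearMap_eq_of_supported (L₁ := addEdge ord f ∘ₗ detachOp ord f v)
      (L₂ := LinearMap.id) (fun S hS => ?_) hc₁
    have hS1 := hS.1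
    rw [Finset.coe_insert, Set.insert_subset_iff] at hS1
    exact addEdge_detachOp ord huv hS1.1
      (reachable_mono (Set.subset_sdiff_singleton hS1.2 hfA) hub)
  have he : detachOp ord f v c₁ ∈ Γ.intervalChains b A (T.erase f) (i - 1) j := by
    refine linearMap_mem_of_supported (fun S hS => ?_) hc₁
    obtain ⟨h1, h2, h3, h4⟩ := hS
    rw [Finset.coe_insert, Set.insert_subset_iff] at h1
    have hA := Set.subset_sdiff_singleton h1.2 hfA
    rw [detachOp_single ord h1.1]
    refine Submodule.smul_mem _ _ (Finsupp.single_mem_supported ℝ 1 ⟨hA, ?_, ?_, ?_⟩)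
    · rw [Finset.coe_erase]
      exact Set.sdiff_subset_sdiff_left h2
    · have := dimension_of_insert (f := f) (S := S.detach f v) (S' := S) (fun h => h.2 rfl)
        (insert_sdiff_of_mem h1.1).symm
      rw [h3] at this
      rw [this]; ring
    · rw [← h4, (detach_specializes huv h1.1 (reachable_mono hA hub)).degree_eq]
  refine ⟨_, intervalChains_mono subset_rfl (T.erase_subset f) _ _ he, ?_⟩
  have heq : c₁ + c₀ - addEdges ord T (detachOp ord f v c₁) =
      c₀ - addEdges ord (T.erase f) (detachOp ord f v c₁) := by
    rw [addEdges_eq_add_erase ord hfT, hsec]; abel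
  have hmem : c₁ + c₀ - addEdges ord T (detachOp ord f v c₁) ∈
      Γ.intervalChains b A (T.erase f) i j := by
    rw [heq]
    have := addEdges_mem ord subset_rfl he
    rw [sub_add_cancel] at this
    exact Submodule.sub_mem _ hc₀ this
  have hd : addEdges ord T (c₁ + c₀ - addEdges ord T (detachOp ord f v c₁)) = 0 := by
    rw [map_sub, hdc, addEdges_addEdges, sub_zero]
  generalize c₁ + c₀ - addEdges ord T (detachOp ord f v c₁) = z at hmem hd
  -- For a cocycle without `f`, the terms of its differential with and without `f` vanish
  -- separately.
  have hdf : addEdge ord f z = 0 := by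
    rw [addEdges_eq_add_erase ord hfT] at hd
    exact (eq_zero_of_add_eq_zero (addEdge_mem ord hfT
      (intervalChains_mono subset_rfl (T.erase_subset f) _ _ hmem))
      (addEdges_mem ord subset_rfl hmem) hd).1
  let P : Γ.EnhancedState b → Prop := fun S =>
    S.colour v = Colour.x ∧ ¬ (Γ.state S.edges).Reachable v b
  have hz := Finsupp.filter_add_filter_not z P
  have hpos : z.filter P ∈ Finsupp.supported ℝ ℝ (Γ.detachedStates b A T f v i j) := by
    intro S hS
    rw [Finset.mem_coe, Finsupp.support_filter, Finset.mem_filter] at hS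
    exact ⟨hmem hS.1, hS.2⟩
  have hneg : z.filter (fun S => ¬ P S) ∈ Finsupp.supported ℝ ℝ
      {S | S ∈ Γ.intervalStates b A (T.erase f) i j ∧ ¬ P S} := by
    intro S hS
    rw [Finset.mem_coe, Finsupp.support_filter, Finset.mem_filter] at hS
    exact ⟨hmem hS.1, hS.2⟩
  have hpos0 := addEdge_eq_zero_of_mem (ord := ord) huv hub hpos
  -- On the states that are not detached `addEdge ord f` has a left inverse, and it kills the
  -- detached ones. So `hdf` forces the rest of `z` to vanish.
  have hneg0 : detachOp ord f v (addEdge ord f (z.filter fun S => ¬ P S)) =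
      z.filter fun S => ¬ P S := by
    refine linearMap_eq_of_supported (L₁ := detachOp ord f v ∘ₗ addEdge ord f)
      (L₂ := LinearMap.id) (fun S hS => ?_) hneg
    refine detachOp_addEdge ord huv (notMem_of_subset_erase hS.1.2.1) (reachable_mono hS.1.1 hub) fun hx => ?_
    by_contra hr
    exact hS.2 ⟨hx, hr⟩
  have hneg1 : z.filter (fun S => ¬ P S) = 0 := by
    rw [← hz, map_add, hpos0, zero_add] at hdf
    rw [← hneg0, hdf, map_zero]
  rw [hneg1, add_zero] at hz
  rw [← hz]
  exact hpos

/-- Both ends of `f` are connected to `b` in every state, so there are no detached states to carry a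
cohomology class. -/
lemma IsExactAt.of_loop {A T : Finset E} (hfT : f ∈ T) (hfA : f ∉ A)
    (huv : Γ.ends f = s(u, v)) (hub : (Γ.state A).Reachable u b)
    (hvb : (Γ.state A).Reachable v b) (i j : ℤ) : IsExactAt Γ b ord A T i j := by
  intro c hc hdc
  obtain ⟨c', hc', h⟩ := exists_cohomologous hfT hfA huv hub hc hdc
  refine ⟨c', hc', ?_⟩
  have : Γ.detachedStates b A T f v i j = ∅ :=
    Set.eq_empty_of_forall_notMem fun S hS => hS.2.2 (reachable_mono hS.1.1 hvb)
  rw [this, Finsupp.supported_empty, Submodule.mem_bot, sub_eq_zero] at h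
  exact h.symm

/-- No other edges of `T` connect `v` to `b`, so erasing `f` identifies the contracted complex, up
to sign and a shift by `(-1, 1)`, with the detached states. A primitive found there is erased back.
-/
lemma IsExactAt.of_bridge [Finite V] {A T : Finset E} (hfT : f ∈ T) (hfA : f ∉ A)
    (huv : Γ.ends f = s(u, v)) (hub : (Γ.state A).Reachable u b)
    (hvb : ¬ (Γ.state (T.erase f)).Reachable v b) {i j : ℤ}
    (h : IsExactAt Γ b ord (insert f A) T (i + 1) (j - 1)) : IsExactAt Γ b ord A T i j := by
  intro c hc hdc
  obtain ⟨b₁, hb₁, hz⟩ := exists_cohomologous hfT hfA huv hub hc hdc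
  have hd : addEdges ord T (c - addEdges ord T b₁) = 0 := by
    rw [map_sub, hdc, addEdges_addEdges, sub_zero]
  suffices hs : ∃ b₂ ∈ Γ.intervalChains b A T (i - 1) j,
      addEdges ord T b₂ = c - addEdges ord T b₁ by
    obtain ⟨b₂, hb₂, hdb₂⟩ := hs
    exact ⟨b₁ + b₂, Submodule.add_mem _ hb₁ hb₂, by rw [map_add, hdb₂]; abel⟩
  generalize c - addEdges ord T b₁ = z at hz hd
  rw [addEdges_eq_add_erase ord hfT, addEdge_eq_zero_of_mem huv hub hz, zero_add] at hd
  have hattach := attachOp_mem (ord := ord) hfT huv hub hz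
  have herase := eraseOp_attachOp_of_mem (ord := ord) huv hub hz
  have hd' : addEdges ord T (attachOp ord f z) = 0 := by
    have h1 := addEdges_eraseOp (ord := ord) hfA huv hub hvb hattach
    rw [herase, hd, eq_comm, neg_eq_zero, ← addEdges_eq_addEdges_erase hfT hattach] at h1
    rw [← attachOp_eraseOp_of_mem (ord := ord) huv hub (addEdges_mem ord subset_rfl hattach), h1,
      map_zero]
  obtain ⟨y, hy, hdy⟩ := h _ hattach hd'
  have hey := eraseOp_mem (ord := ord) hfA huv hub hvb hy
  rw [add_sub_cancel_right, sub_add_cancel] at hey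
  refine ⟨- eraseOp ord f y, Submodule.neg_mem _ (mem_of_mem_detached hey), ?_⟩
  rw [map_neg, addEdges_eq_add_erase ord hfT, addEdge_eq_zero_of_mem huv hub hey, zero_add,
    addEdges_eraseOp hfA huv hub hvb hy, neg_neg, ← addEdges_eq_addEdges_erase hfT hy, hdy,
    herase]

/-- The cohomology of the minor given by `A` and `T` is concentrated on one diagonal. -/
theorem isExactAt_of_connected [Finite V] {A T : Finset E} (hAT : A ⊆ T)
    (hT : ∀ w, (Γ.state T).Reachable w b) {i j : ℤ}
    (hij : i + j ≠ A.card + (Γ.allX b A).degree) : IsExactAt Γ b ord A T i j := by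
  induction hn : (T \ A).card using Nat.strong_induction_on generalizing A T i j with
  | _ n ih =>
  by_cases hex : ∃ f ∈ T, ∃ u v, Γ.ends f = s(u, v) ∧ (Γ.state A).Reachable u b ∧
      ¬ (Γ.state A).Reachable v b
  · obtain ⟨f, hfT, u, v, huv, hub, hvb⟩ := hex
    have hfA : f ∉ A := fun h => hvb ((reachable_of_ends h huv).symm.trans hub)
    have hdeg := degree_allX_insert hfA huv hub hvb
    have hsub : insert f A ⊆ T := Finset.insert_subset hfT hAT
    have hlt : (T \ insert f A).card < n := by
      rw [← hn]
      refine Finset.card_lt_card (Finset.ssubset_iff_of_subset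
        (Finset.sdiff_subset_sdiff subset_rfl (Finset.subset_insert f A)) |>.2 ⟨f, ?_, ?_⟩)
      · exact Finset.mem_sdiff.2 ⟨hfT, hfA⟩
      · simp
    have hcontr : ∀ {i j : ℤ}, i + j ≠ A.card + (Γ.allX b A).degree →
        IsExactAt Γ b ord (insert f A) T i j := by
      intro i j hij
      refine ih _ hlt hsub hT ?_ rfl
      rw [Finset.card_insert_of_notMem hfA, Finset.coe_insert]
      rw [hdeg] at hij
      push_cast
      intro h
      exact hij (by rw [h]; ring)
    -- This decides whether `f` is a bridge of the minor; deletion is available only if `T` stays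
    -- connected. The shift in the bridge case preserves `i + j`.
    by_cases hbr : (Γ.state (T.erase f)).Reachable v b
    · refine IsExactAt.of_erase_of_insert hfT ?_ (hcontr hij)
      refine ih _ ?_ (Finset.subset_erase.2 ⟨hAT, hfA⟩) ?_ hij rfl
      · rw [← hn]
        refine Finset.card_lt_card (Finset.ssubset_iff_of_subset
          (Finset.sdiff_subset_sdiff (T.erase_subset f) subset_rfl) |>.2 ⟨f, ?_, ?_⟩)
        · exact Finset.mem_sdiff.2 ⟨hfT, hfA⟩
        · simp
      · intro w
        have hub' : (Γ.state (T.erase f)).Reachable u b :=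
          reachable_mono (Finset.coe_subset.2 (Finset.subset_erase.2 ⟨hAT, hfA⟩)) hub
        have hw := hT w
        rw [← Finset.insert_erase hfT, Finset.coe_insert, reachable_insert huv] at hw
        rcases hw with h | ⟨h1, h2⟩ | ⟨h1, h2⟩
        · exact h
        · exact h1.trans hub'
        · exact h1.trans hbr
    · exact IsExactAt.of_bridge hfT hfA huv hub hbr (hcontr (by rwa [add_add_sub_cancel]))
  · push Not at hex
    -- No edge of `T` leaves the component of `b` in `A`, and `T` is connected, so that component is
    -- everything.
    have hA : ∀ w, (Γ.state A).Reachable w b := by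
      intro w
      have : (Γ.state A).Reachable b b ↔ (Γ.state A).Reachable w b :=
        reachable_least (R := fun u v => (Γ.state A).Reachable u b ↔ (Γ.state A).Reachable v b)
          ⟨fun _ => Iff.rfl, Iff.symm, Iff.trans⟩ (fun f hf u v huv =>
            ⟨hex f hf u v huv, hex f hf v u (huv.trans Sym2.eq_swap)⟩) (hT w).symm
      exact this.1 (SimpleGraph.Reachable.refl b)
    by_cases hTA : T ⊆ A
    · obtain rfl := Finset.Subset.antisymm hAT hTA
      -- The only state is the connected one, coloured `x`, and it lies on the excluded diagonal.
      have hempty : Γ.intervalStates b A A i j = ∅ := by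
        refine Set.eq_empty_of_forall_notMem fun S hS => hij ?_
        obtain ⟨h1, h2, h3, h4⟩ := hS
        have hSA : S.edges = A := Set.Subset.antisymm h2 h1
        have hSx : S = Γ.allX b A := EnhancedState.ext hSA (funext fun w =>
          colour_x_of_reachable S.colour_base (hSA ▸ (hA w).symm))
        rw [← h3, ← h4, hSx, dimension]
        simp [allX]
      intro c hc _
      rw [intervalChains, hempty, Finsupp.supported_empty, Submodule.mem_bot] at hc
      exact ⟨0, Submodule.zero_mem _, by rw [hc, map_zero]⟩
    · obtain ⟨f, hfT, hfA⟩ := Finset.not_subset.1 hTA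
      obtain ⟨u, v, huv⟩ : ∃ u v, Γ.ends f = s(u, v) :=
        ⟨_, _, (Sym2.mk_surjective (Γ.ends f)).choose_spec.symm⟩
      exact IsExactAt.of_loop hfT hfA huv (hA u) (hA v) i j

end Exactness

/-! ### Back to the original complex: vanishing and the Euler–Poincaré formula -/

section Cohomology

open Classical EnhancedState

variable {V E : Type*} {Γ : IncidenceGraph V E} {b : V}

instance [Finite V] [Finite E] : Finite (Γ.EnhancedState b) := by
  have : Finite Colour := Finite.of_injective (fun c : Colour => decide (c = Colour.x)) (by
    intro c c' h
    exact colour_ext (by simpa using h))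
  refine Finite.of_injective (fun S : Γ.EnhancedState b => (S.edges, S.colour)) fun S S' h => ?_
  exact EnhancedState.ext (congrArg Prod.fst h) (congrArg Prod.snd h)

variable (Γ b) in
/-- The cochains as finitely supported functions. -/
noncomputable def cochainEquiv : Γ.Cochain b ≃ₗ[ℝ] (Γ.EnhancedState b →₀ ℝ) :=
  LinearEquiv.refl ℝ (Γ.EnhancedState b →₀ ℝ)

lemma cochainEquiv_toCochain (S : Γ.EnhancedState b) :
    Γ.cochainEquiv b S.toCochain = Finsupp.single S 1 := rfl

instance [Finite V] [Finite E] : Module.Finite ℝ (Γ.Cochain b) :=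
  Module.Finite.equiv (Γ.cochainEquiv b).symm

lemma map_cochainGroup [Fintype E] (i j : ℤ) :
    (Γ.cochainGroup b i j).map (Γ.cochainEquiv b).toLinearMap =
      Γ.intervalChains b ∅ Finset.univ i j := by
  rw [cochainGroup, Submodule.map_span, intervalChains, Finsupp.supported_eq_span_single]
  congr 1
  ext c
  constructor
  · rintro ⟨_, ⟨S, hi, hj, rfl⟩, rfl⟩
    exact ⟨S, ⟨by simp, by simp, hi, hj⟩, rfl⟩
  · rintro ⟨S, ⟨-, -, hi, hj⟩, rfl⟩
    exact ⟨_, ⟨S, hi, hj, rfl⟩, rfl⟩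

lemma mem_cochainGroup_iff [Fintype E] {i j : ℤ} {c : Γ.Cochain b} :
    c ∈ Γ.cochainGroup b i j ↔
      Γ.cochainEquiv b c ∈ Γ.intervalChains b ∅ Finset.univ i j := by
  rw [← map_cochainGroup]
  constructor
  · exact fun h => ⟨c, h, rfl⟩
  · rintro ⟨c', h, hc⟩
    rwa [← (Γ.cochainEquiv b).injective hc]

lemma finsum_addsEdge (S : Γ.EnhancedState b) {f : E} (r : ℝ) :
    Γ.cochainEquiv b (∑ᶠ S' : {S' : Γ.EnhancedState b // S.AddsEdge f S'}, r • S'.1.toCochain) =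
      r • S.push (insert f S.edges) := by
  rcases S.push_eq_zero_or (insert f S.edges) with h | ⟨S', h1, h2, h3⟩
  · have : IsEmpty {S' : Γ.EnhancedState b // S.AddsEdge f S'} := by
      refine ⟨fun ⟨S', hS'⟩ => ?_⟩
      obtain ⟨h1, h2⟩ := addsEdge_iff.1 hS'
      rw [h2.push_eq h1] at h
      exact one_ne_zero (Finsupp.single_eq_zero.1 h)
    rw [finsum_of_isEmpty, h, map_zero, smul_zero]
  · have hS' := addsEdge_iff.2 ⟨h1, h2⟩
    rw [finsum_eq_single _ ⟨S', hS'⟩, map_smul, cochainEquiv_toCochain, h3]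
    rintro ⟨S'', hS''⟩ hne
    obtain ⟨h1', h2'⟩ := addsEdge_iff.1 hS''
    exact absurd (Subtype.ext (h2'.unique h2 (h1'.trans h1.symm))) hne

/-- Transfers the differential to the one-edge operators, for which exactness has been proved. -/
lemma cochainEquiv_differential [Fintype E] (ord : LinearOrder E) (c : Γ.Cochain b) :
    Γ.cochainEquiv b (Γ.differential b ord c) =
      addEdges (.ofLinearOrder ord) Finset.univ (Γ.cochainEquiv b c) := by
  have h : (Γ.cochainEquiv b).toLinearMap ∘ₗ Γ.differential b ord ∘ₗ
      (Γ.cochainEquiv b).symm.toLinearMap = addEdges (.ofLinearOrder ord) Finset.univ := by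
    refine Finsupp.lhom_ext' fun S => LinearMap.ext_ring ?_
    have hd : Γ.differential b ord S.toCochain =
        ∑ᶠ e : {e : E // e ∉ S.edges}, ∑ᶠ S' : {S' : Γ.EnhancedState b // S.AddsEdge e.1 S'},
          ((-1 : ℝ) ^ {f : E | f ∈ S.edges ∧ ord.lt f e.1}.ncard) • S'.1.toCochain :=
      (Finsupp.linearCombination_single ℝ _ _).trans (one_smul _ _)
    change Γ.cochainEquiv b (Γ.differential b ord S.toCochain) =
      addEdges (.ofLinearOrder ord) Finset.univ (Finsupp.single S 1)
    rw [hd, finsum_eq_sum_of_fintype, map_sum, addEdges_apply]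
    simp_rw [addEdge_single, ← ite_not (_ ∈ S.edges), ← Finset.sum_filter]
    rw [Finset.sum_subtype (p := fun e => e ∉ S.edges) _ (by simp)]
    exact Finset.sum_congr rfl fun e _ => finsum_addsEdge S _
  have := LinearMap.congr_fun h (Γ.cochainEquiv b c)
  simpa using this

lemma differential_differential [Finite E] (ord : LinearOrder E) (c : Γ.Cochain b) :
    Γ.differential b ord (Γ.differential b ord c) = 0 := by
  have := Fintype.ofFinite E
  apply (Γ.cochainEquiv b).injective
  rw [cochainEquiv_differential, cochainEquiv_differential, addEdges_addEdges, map_zero]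

lemma coboundaries_le_cocycles [Finite E] (ord : LinearOrder E) (i j : ℤ) :
    Γ.coboundaries b ord i j ≤ Γ.cocycles b ord i j := by
  have := Fintype.ofFinite E
  rintro _ ⟨c, hc, rfl⟩
  refine ⟨?_, differential_differential ord c⟩
  have h := addEdges_mem (.ofLinearOrder ord) subset_rfl (mem_cochainGroup_iff.1 hc)
  rw [sub_add_cancel] at h
  exact mem_cochainGroup_iff.2 (by rwa [cochainEquiv_differential])

lemma degree_allX_empty [Finite V] : (Γ.allX b ∅).degree = (Nat.card V : ℤ) - 1 := by
  rw [EnhancedState.degree_eq]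
  have h : (Γ.state (Γ.allX b ∅).edges).connectedComponentMk ''
      {v | (Γ.allX b ∅).colour v = Colour.x} =
      Set.range (Γ.state (Γ.allX b ∅).edges).connectedComponentMk := by
    rw [← Set.image_univ]
    exact congrArg _ (Set.eq_univ_of_forall fun v => rfl)
  rw [h, ← Set.image_univ, Set.ncard_image_of_injective, Set.ncard_univ]
  intro u v huv
  refine reachable_least (Γ := Γ) (s := ∅) ⟨fun _ => rfl, Eq.symm, Eq.trans⟩ ?_
    (SimpleGraph.ConnectedComponent.exact huv)
  rintro f ⟨⟩

/-- The case `A = ∅`, `T = univ` of concentration; with no edges every vertex is a component, so the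
diagonal is `|V| - 1`. -/
lemma finrank_reducedCohomology_eq_zero [Finite V] [Finite E] (ord : LinearOrder E)
    (hconn : (Γ.state Set.univ).Connected) {i j : ℤ} (hij : i + j ≠ (Nat.card V : ℤ) - 1) :
    Module.finrank ℝ (Γ.ReducedCohomology b ord i j) = 0 := by
  have := Fintype.ofFinite E
  have hex : IsExactAt Γ b (.ofLinearOrder ord) ∅ Finset.univ i j :=
    isExactAt_of_connected (Finset.empty_subset _)
      (fun w => by rw [Finset.coe_univ]; exact hconn.preconnected w b)
      (by rwa [Finset.card_empty, Finset.coe_empty, degree_allX_empty, Nat.cast_zero, zero_add])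
  have hle : Γ.cocycles b ord i j ≤ Γ.coboundaries b ord i j := by
    rintro c ⟨hc, hd⟩
    obtain ⟨c', hc', h⟩ := hex _ (mem_cochainGroup_iff.1 hc) (by
      rw [← cochainEquiv_differential, show Γ.differential b ord c = 0 from hd, map_zero])
    refine ⟨(Γ.cochainEquiv b).symm c', mem_cochainGroup_iff.2 (by simpa using hc'), ?_⟩
    apply (Γ.cochainEquiv b).injective
    rw [cochainEquiv_differential, LinearEquiv.apply_symm_apply, h]
  have : Subsingleton (Γ.ReducedCohomology b ord i j) :=
    Submodule.Quotient.subsingleton_iff.2 (Submodule.submoduleOf_eq_top.2 hle)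
  exact Module.finrank_zero_of_subsingleton

lemma finrank_cocycles [Finite V] [Finite E] (ord : LinearOrder E) (i j : ℤ) :
    Module.finrank ℝ (Γ.cocycles b ord i j) = Module.finrank ℝ (Γ.ReducedCohomology b ord i j) +
      Module.finrank ℝ (Γ.coboundaries b ord i j) := by
  rw [← Submodule.finrank_quotient_add_finrank
    ((Γ.coboundaries b ord i j).submoduleOf (Γ.cocycles b ord i j)),
    (Submodule.submoduleOfEquivOfLe (coboundaries_le_cocycles ord i j)).finrank_eq]

lemma finrank_cochainGroup [Finite V] [Finite E] (ord : LinearOrder E) (i j : ℤ) :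
    Module.finrank ℝ (Γ.cochainGroup b i j) = Module.finrank ℝ (Γ.cocycles b ord i j) +
      Module.finrank ℝ (Γ.coboundaries b ord (i + 1) j) := by
  rw [← LinearMap.finrank_range_add_finrank_ker
    ((Γ.differential b ord).domRestrict (Γ.cochainGroup b i j)), LinearMap.range_domRestrict,
    LinearMap.ker_domRestrict, ← Submodule.finrank_map_subtype_eq, Submodule.map_comap_subtype,
    coboundaries, add_sub_cancel_right, add_comm, cocycles]

lemma cochainGroup_eq_bot (i j : ℤ) (h : ∀ S : Γ.EnhancedState b, S.dimension ≠ i) :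
    Γ.cochainGroup b i j = ⊥ := by
  rw [cochainGroup, Submodule.span_eq_bot]
  rintro _ ⟨S, hS, -⟩
  exact absurd hS (h S)

lemma sum_neg_one_pow_eq {z h d : ℕ → ℤ} (hz : ∀ i, z i = h i + d i) (n : ℕ) :
    ∑ i ∈ Finset.range n, (-1) ^ i * (z i + d (i + 1)) =
      ∑ i ∈ Finset.range n, (-1) ^ i * h i + d 0 - (-1) ^ n * d n := by
  induction n with
  | zero => simp
  | succ n ih => rw [Finset.sum_range_succ, Finset.sum_range_succ, ih, hz, pow_succ]; ring

lemma sum_finrank_cochainGroup [Finite V] [Finite E] (ord : LinearOrder E) (j : ℤ) :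
    ∑ i ∈ Finset.range (Nat.card E + 1),
        (-1 : ℤ) ^ i * Module.finrank ℝ (Γ.cochainGroup b i j) =
      ∑ i ∈ Finset.range (Nat.card E + 1),
        (-1 : ℤ) ^ i * Module.finrank ℝ (Γ.ReducedCohomology b ord i j) := by
  have h := sum_neg_one_pow_eq
    (z := fun i => (Module.finrank ℝ (Γ.cocycles b ord i j) : ℤ))
    (h := fun i => (Module.finrank ℝ (Γ.ReducedCohomology b ord i j) : ℤ))
    (d := fun i => (Module.finrank ℝ (Γ.coboundaries b ord i j) : ℤ))
    (fun i => by rw [finrank_cocycles]; push_cast; rfl) (Nat.card E + 1)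
  -- There are no states of dimension `-1` or `|E| + 1`, so both boundary terms of the telescoping
  -- sum vanish.
  have h0 : Module.finrank ℝ (Γ.coboundaries b ord (0 : ℕ) j) = 0 := by
    rw [coboundaries, cochainGroup_eq_bot, Submodule.map_bot, finrank_bot]
    intro S hS
    have : 0 ≤ S.dimension := Int.natCast_nonneg _
    omega
  have h1 : Module.finrank ℝ (Γ.coboundaries b ord (Nat.card E + 1 : ℕ) j) = 0 := by
    have hle := coboundaries_le_cocycles (Γ := Γ) (b := b) ord (Nat.card E + 1 : ℕ) j
    have hbot : Γ.cochainGroup b (Nat.card E + 1 : ℕ) j = ⊥ := by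
      refine cochainGroup_eq_bot _ _ fun S hS => ?_
      have : S.edges.ncard ≤ Nat.card E := Set.ncard_le_card S.edges
      rw [dimension] at hS
      omega
    rw [cocycles, hbot, bot_inf_eq, le_bot_iff] at hle
    rw [hle, finrank_bot]
  rw [h0, h1] at h
  simp only [Nat.cast_zero, mul_zero, add_zero, sub_zero] at h
  rw [← h]
  refine Finset.sum_congr rfl fun i _ => ?_
  rw [finrank_cochainGroup ord]
  push_cast; rfl

end Cohomology

/-! ### Euler characteristics as state sums -/

section EulerCharacteristic

open Classical EnhancedState

variable {V E : Type*} {Γ : IncidenceGraph V E} {b : V}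

/-- The number of connected components of the state `s`. -/
noncomputable def numComponents (Γ : IncidenceGraph V E) (s : Set E) : ℕ :=
  Nat.card (Γ.state s).ConnectedComponent

/-- The Euler characteristic of the reduced chromatic complex in degree `j`. -/
noncomputable def eulerChar (Γ : IncidenceGraph V E) [Fintype E] (j : ℕ) : ℤ :=
  ∑ s : Finset E, (-1) ^ s.card * ((Γ.numComponents s - 1).choose j : ℤ)

/-- The enhanced state in which the component of `b` and those in `X` are coloured `x`. -/
noncomputable def ofComponents (Γ : IncidenceGraph V E) (b : V) (s : Set E)
    (X : Set (Γ.state s).ConnectedComponent) : Γ.EnhancedState b where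
  edges := s
  colour v := if (Γ.state s).connectedComponentMk v ∈
    insert ((Γ.state s).connectedComponentMk b) X then Colour.x else Colour.one
  colour_eq u v h := by rw [SimpleGraph.ConnectedComponent.sound h]
  colour_base := if_pos (Or.inl rfl)

lemma ofComponents_colour_iff (s : Set E) (X : Set (Γ.state s).ConnectedComponent) (v : V) :
    (Γ.ofComponents b s X).colour v = Colour.x ↔ (Γ.state s).connectedComponentMk v ∈
      insert ((Γ.state s).connectedComponentMk b) X := by
  simp only [ofComponents]
  split_ifs with h <;> simp [h]

lemma image_ofComponents (s : Set E) (X : Set (Γ.state s).ConnectedComponent) :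
    (Γ.state s).connectedComponentMk '' {v | (Γ.ofComponents b s X).colour v = Colour.x} =
      insert ((Γ.state s).connectedComponentMk b) X := by
  ext K
  induction K using SimpleGraph.ConnectedComponent.ind with
  | _ v =>
    constructor
    · rintro ⟨u, hu, h⟩
      rw [← h]
      exact (ofComponents_colour_iff s X u).1 hu
    · exact fun h => ⟨v, (ofComponents_colour_iff s X v).2 h, rfl⟩

/-- The base component is forced to be `x` and is discounted by the `- 1` in the degree, so `j` of
the other components are to be chosen. -/
lemma ncard_states [Finite V] (s : Set E) (j : ℕ) :
    {S : Γ.EnhancedState b | S.edges = s ∧ S.degree = j}.ncard =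
      (Γ.numComponents s - 1).choose j := by
  have := Fintype.ofFinite (Γ.state s).ConnectedComponent
  set K := (Γ.state s).connectedComponentMk b with hK
  set P : Finset (Finset (Γ.state s).ConnectedComponent) :=
    Finset.powersetCard j (Finset.univ.erase K) with hP
  have hmem : ∀ X : Finset (Γ.state s).ConnectedComponent, X ∈ P ↔ K ∉ X ∧ X.card = j := by
    intro X
    rw [hP, Finset.mem_powersetCard, Finset.subset_erase]
    simp
  have himg : {S : Γ.EnhancedState b | S.edges = s ∧ S.degree = j} =
      (fun X : Finset (Γ.state s).ConnectedComponent => Γ.ofComponents b s X) '' P := by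
    ext S
    constructor
    · rintro ⟨rfl, hd⟩
      rw [EnhancedState.degree_eq] at hd
      set Y := (Γ.state S.edges).connectedComponentMk '' {v | S.colour v = Colour.x} with hY
      have hKY : K ∈ Y := ⟨b, S.colour_base, rfl⟩
      refine ⟨Y.toFinset.erase K, ?_, ?_⟩
      · rw [Finset.mem_coe, hmem]
        refine ⟨Finset.notMem_erase K _, ?_⟩
        rw [Finset.card_erase_of_mem (Set.mem_toFinset.2 hKY), ← Set.ncard_eq_toFinset_card']
        omega
      · refine ext_of_colour_iff rfl fun v => ?_
        rw [ofComponents_colour_iff, Finset.coe_erase, Set.coe_toFinset,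
          Set.insert_sdiff_singleton, Set.insert_eq_of_mem hKY]
        constructor
        · rintro ⟨u, hu, h⟩
          exact colour_x_of_reachable hu (SimpleGraph.ConnectedComponent.exact h)
        · exact fun h => ⟨v, h, rfl⟩
    · rintro ⟨X, hX, rfl⟩
      obtain ⟨h1, h2⟩ := (hmem X).1 hX
      refine ⟨rfl, ?_⟩
      rw [EnhancedState.degree_eq]
      change (((Γ.state s).connectedComponentMk ''
        {v | (Γ.ofComponents b s X).colour v = Colour.x}).ncard : ℤ) - 1 = j
      rw [image_ofComponents, Set.ncard_insert_of_notMem (by simpa using h1),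
        Set.ncard_coe_finset, h2]
      push_cast; ring
  rw [himg, Set.InjOn.ncard_image, Set.ncard_coe_finset, hP, Finset.card_powersetCard,
    Finset.card_erase_of_mem (Finset.mem_univ K), Finset.card_univ, numComponents,
    Nat.card_eq_fintype_card]
  intro X hX Y hY hXY
  have hX := ((hmem X).1 hX).1
  have hY := ((hmem Y).1 hY).1
  have h : insert K (X : Set (Γ.state s).ConnectedComponent) = insert K (Y : Set _) := by
    have hXY : Γ.ofComponents b s X = Γ.ofComponents b s Y := hXY
    rw [hK, ← image_ofComponents (b := b), ← image_ofComponents (b := b), hXY]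
  rw [← Finset.coe_insert, ← Finset.coe_insert, Finset.coe_inj] at h
  rw [← Finset.erase_insert hX, h, Finset.erase_insert hY]

lemma finrank_cochainGroup_eq_ncard [Finite V] [Finite E] (i j : ℤ) :
    Module.finrank ℝ (Γ.cochainGroup b i j) =
      {S : Γ.EnhancedState b | S.dimension = i ∧ S.degree = j}.ncard := by
  have := Fintype.ofFinite E
  have := Fintype.ofFinite (Γ.EnhancedState b)
  rw [((Γ.cochainEquiv b).submoduleMap (Γ.cochainGroup b i j)).finrank_eq]
  have h := map_cochainGroup (Γ := Γ) (b := b) i j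
  have hs : Γ.intervalStates b ∅ Finset.univ i j =
      {S : Γ.EnhancedState b | S.dimension = i ∧ S.degree = j} := by
    ext S; simp [intervalStates]
  have h2 : (Γ.cochainGroup b i j).map (Γ.cochainEquiv b).toLinearMap =
      Finsupp.supported ℝ ℝ {S : Γ.EnhancedState b | S.dimension = i ∧ S.degree = j} := by
    rw [h, intervalChains, hs]
  refine (congrArg (fun N : Submodule ℝ (Γ.EnhancedState b →₀ ℝ) => Module.finrank ℝ N) h2).trans ?_
  change Module.finrank ℝ (Finsupp.supported ℝ ℝ
    {S : Γ.EnhancedState b | S.dimension = i ∧ S.degree = j}) = _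
  rw [(Finsupp.supportedEquivFinsupp _).finrank_eq, Module.finrank_finsupp_self,
    ← Nat.card_eq_fintype_card, Nat.card_coe_set_eq]

lemma finrank_cochainGroup_eq_sum [Finite V] [Fintype E] (i j : ℕ) :
    Module.finrank ℝ (Γ.cochainGroup b i j) =
      ∑ s : Finset E, if s.card = i then (Γ.numComponents s - 1).choose j else 0 := by
  have := Fintype.ofFinite (Γ.EnhancedState b)
  rw [finrank_cochainGroup_eq_ncard, Set.ncard_eq_toFinset_card',
    Finset.card_eq_sum_card_fiberwise (f := fun S => S.edges.toFinset) (t := Finset.univ)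
      (fun _ _ => Finset.mem_coe.2 (Finset.mem_univ _))]
  refine Finset.sum_congr rfl fun s _ => ?_
  have hdim : ∀ S : Γ.EnhancedState b, S.edges.toFinset = s → S.dimension = s.card := by
    rintro S rfl
    rw [dimension, Set.ncard_eq_toFinset_card']
  split_ifs with hs
  · rw [← ncard_states (b := b), Set.ncard_eq_toFinset_card']
    congr 1
    ext S
    have h : S.edges.toFinset = s ↔ S.edges = s := by
      rw [← Finset.coe_inj, Set.coe_toFinset]
    simp only [Finset.mem_filter, Set.mem_toFinset, Set.mem_ofPred_eq]
    constructor
    · exact fun ⟨⟨_, h1⟩, h2⟩ => ⟨h.1 h2, h1⟩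
    · exact fun ⟨h1, h2⟩ => ⟨⟨by rw [hdim S (h.2 h1), hs], h2⟩, h.2 h1⟩
  · rw [Finset.card_eq_zero, Finset.filter_eq_empty_iff]
    intro S hS hSs
    have h1 := (Set.mem_toFinset.1 hS).1
    rw [hdim S hSs] at h1
    exact hs (by exact_mod_cast h1)

lemma sum_finrank_reducedCohomology [Finite V] [Fintype E] (ord : LinearOrder E) (j : ℕ) :
    ∑ i ∈ Finset.range (Nat.card E + 1),
        (-1 : ℤ) ^ i * Module.finrank ℝ (Γ.ReducedCohomology b ord i j) = Γ.eulerChar j := by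
  rw [← sum_finrank_cochainGroup]
  simp_rw [finrank_cochainGroup_eq_sum, Nat.cast_sum, Finset.mul_sum]
  rw [Finset.sum_comm, eulerChar]
  refine Finset.sum_congr rfl fun s _ => ?_
  rw [Finset.sum_eq_single s.card]
  · simp
  · intro i _ hi
    simp [hi.symm]
  · intro h
    rw [Finset.mem_range, Nat.card_eq_fintype_card, Nat.lt_succ_iff] at h
    exact absurd (Finset.card_le_univ s) h

/-- The Poincaré polynomial of a connected graph is determined by its Euler characteristics. -/
theorem poincarePolynomial_eq [Finite V] [Fintype E] (ord : LinearOrder E)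
    (hconn : (Γ.state Set.univ).Connected) :
    Γ.poincarePolynomial b ord = ∑ j ∈ Finset.range (Nat.card V),
      MvPolynomial.C ((-1) ^ (Nat.card V - 1 - j) * Γ.eulerChar j) *
        MvPolynomial.X 0 ^ (Nat.card V - 1 - j) * MvPolynomial.X 1 ^ j := by
  rw [poincarePolynomial, Finset.sum_comm]
  refine Finset.sum_congr rfl fun j hj => ?_
  rw [Finset.mem_range] at hj
  have hzero : ∀ i : ℕ, i ≠ Nat.card V - 1 - j →
      Module.finrank ℝ (Γ.ReducedCohomology b ord i j) = 0 := fun i hi =>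
    finrank_reducedCohomology_eq_zero ord hconn (by omega)
  have hsum := sum_finrank_reducedCohomology (Γ := Γ) (b := b) ord j
  by_cases hm : Nat.card V - 1 - j ∈ Finset.range (Nat.card E + 1)
  · rw [Finset.sum_eq_single_of_mem _ hm (fun i _ hi => by rw [hzero i hi]; simp)] at hsum ⊢
    rw [← hsum, ← mul_assoc, ← mul_pow]
    simp
  -- The diagonal lies outside the summation range. Connectedness in fact excludes this, but it is
  -- simpler to see that both sides are zero.
  · have hi : ∀ i ∈ Finset.range (Nat.card E + 1), i ≠ Nat.card V - 1 - j :=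
      fun i hi h => hm (h ▸ hi)
    rw [Finset.sum_eq_zero fun i h => by rw [hzero i (hi i h)]; simp] at hsum ⊢
    rw [← hsum]
    simp

end EulerCharacteristic

/-! ### Deletion, contraction and parallel edges in the state sum -/

section DeletionContraction

open Classical

variable {V E V' E' : Type*} {Γ : IncidenceGraph V E} {Γ' : IncidenceGraph V' E'}

/-- Serves deletion, with `φ = id`, and contraction, where `φ` identifies only vertices that the
state already connects. -/
lemma reachable_map_iff {s : Set E} {s' : Set E'} {φ : V → V'} (hφ : Function.Surjective φ)
    (hker : ∀ u v, φ u = φ v → (Γ.state s).Reachable u v)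
    (hmap : ∀ f ∈ s, ∀ u v, Γ.ends f = s(u, v) → (Γ'.state s').Reachable (φ u) (φ v))
    (hlift : ∀ f ∈ s', ∀ x y, Γ'.ends f = s(x, y) →
      ∃ u v, φ u = x ∧ φ v = y ∧ (Γ.state s).Reachable u v) (u v : V) :
    (Γ'.state s').Reachable (φ u) (φ v) ↔ (Γ.state s).Reachable u v := by
  constructor
  · intro h
    refine reachable_least (Γ := Γ') (s := s')
      (R := fun x y => ∀ u v, φ u = x → φ v = y → (Γ.state s).Reachable u v)
      ⟨?_, ?_, ?_⟩ ?_ h u v rfl rfl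
    · rintro _ u v rfl hv
      exact hker u v hv.symm
    · exact fun h u v hu hv => (h v u hv hu).symm
    · intro x y z h1 h2 u v hu hv
      obtain ⟨w, hw⟩ := hφ y
      exact (h1 u w hu hw).trans (h2 w v hw hv)
    · rintro f hf x y hxy u v rfl rfl
      obtain ⟨u', v', hu, hv, h⟩ := hlift f hf _ _ hxy
      exact ((hker u u' hu.symm).trans h).trans (hker v' v hv)
  · exact reachable_least (R := fun u v => (Γ'.state s').Reachable (φ u) (φ v))
      ⟨fun _ => SimpleGraph.Reachable.refl _, SimpleGraph.Reachable.symm,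
        SimpleGraph.Reachable.trans⟩ hmap

lemma numComponents_eq {s : Set E} {s' : Set E'} {φ : V → V'} (hφ : Function.Surjective φ)
    (h : ∀ u v, (Γ'.state s').Reachable (φ u) (φ v) ↔ (Γ.state s).Reachable u v) :
    Γ'.numComponents s' = Γ.numComponents s := by
  refine (Nat.card_eq_of_bijective (fun K : (Γ.state s).ConnectedComponent =>
    (Quot.map φ (fun u v => (h u v).2) K : (Γ'.state s').ConnectedComponent)) ⟨?_, ?_⟩).symm
  · intro K L hKL
    induction K using SimpleGraph.ConnectedComponent.ind with
    | _ u =>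
      induction L using SimpleGraph.ConnectedComponent.ind with
      | _ v =>
        exact SimpleGraph.ConnectedComponent.sound
          ((h u v).1 (SimpleGraph.ConnectedComponent.exact hKL))
  · intro K
    induction K using SimpleGraph.ConnectedComponent.ind with
    | _ x =>
      obtain ⟨u, rfl⟩ := hφ x
      exact ⟨(Γ.state s).connectedComponentMk u, rfl⟩

lemma numComponents_le_card [Finite V] (s : Set E) : Γ.numComponents s ≤ Nat.card V :=
  Nat.card_le_card_of_surjective (Γ.state s).connectedComponentMk Quot.exists_rep

lemma eulerChar_eq_zero [Finite V] [Nonempty V] [Fintype E] : Γ.eulerChar (Nat.card V) = 0 := by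
  refine Finset.sum_eq_zero fun s _ => ?_
  have h1 := numComponents_le_card (Γ := Γ) (s : Set E)
  have h2 : 0 < Nat.card V := Nat.card_pos
  rw [Nat.choose_eq_zero_of_lt (by omega), Nat.cast_zero, mul_zero]

lemma sum_powerset_erase [Fintype E] [Fintype E'] {f : E} (ι : E' ↪ E)
    (hι : ∀ g, g ∈ Set.range ι ↔ g ≠ f) (F : Finset E → ℤ) :
    ∑ s ∈ (Finset.univ.erase f).powerset, F s = ∑ s : Finset E', F (s.map ι) := by
  symm
  refine Finset.sum_nbij (fun s => s.map ι) ?_ ?_ ?_ fun _ _ => rfl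
  · intro s _
    rw [Finset.mem_powerset]
    intro g hg
    obtain ⟨g', -, rfl⟩ := Finset.mem_map.1 hg
    exact Finset.mem_erase.2 ⟨(hι _).1 ⟨g', rfl⟩, Finset.mem_univ _⟩
  · exact (Finset.map_injective ι).injOn
  · intro s hs
    rw [Finset.mem_coe, Finset.mem_powerset] at hs
    refine ⟨Finset.univ.filter fun g => ι g ∈ s, Finset.mem_coe.2 (Finset.mem_univ _), ?_⟩
    ext g
    simp only [Finset.mem_map, Finset.mem_filter, Finset.mem_univ, true_and]
    constructor
    · rintro ⟨g', h, rfl⟩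
      exact h
    · intro hg
      obtain ⟨g', rfl⟩ := (hι g).2 (Finset.ne_of_mem_erase (hs hg))
      exact ⟨g', hg, rfl⟩

/-- The Euler characteristics satisfy deletion-contraction. -/
theorem eulerChar_deletion_contraction {E₀ : Type*} [Fintype E] [Fintype E'] [Fintype E₀] {f : E}
    {Γ₀ : IncidenceGraph V E₀} (ι₀ : E₀ ↪ E) (hι₀ : ∀ g, g ∈ Set.range ι₀ ↔ g ≠ f)
    (h₀ : ∀ g, Γ₀.ends g = Γ.ends (ι₀ g)) (ι : E' ↪ E) (hι : ∀ g, g ∈ Set.range ι ↔ g ≠ f)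
    {φ : V → V'} (hφ : Function.Surjective φ)
    (hker : ∀ u v, φ u = φ v → u = v ∨ Γ.ends f = s(u, v))
    (hf : ∀ u v, Γ.ends f = s(u, v) → φ u = φ v)
    (h : ∀ g, Γ'.ends g = Sym2.map φ (Γ.ends (ι g))) (j : ℕ) :
    Γ.eulerChar j = Γ₀.eulerChar j - Γ'.eulerChar j := by
  -- Edge sets without `f` are the states of the deletion. Those with `f` are the states of the
  -- contraction with one more edge, hence the minus sign.
  have huniv : (Finset.univ : Finset (Finset E)) = (insert f (Finset.univ.erase f)).powerset := by
    rw [Finset.insert_erase (Finset.mem_univ f), Finset.powerset_univ]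
  rw [eulerChar, huniv, Finset.sum_powerset_insert (Finset.notMem_erase f _),
    sum_powerset_erase ι₀ hι₀, sum_powerset_erase ι hι, sub_eq_add_neg, eulerChar, eulerChar,
    ← Finset.sum_neg_distrib]
  congr 1
  · refine Finset.sum_congr rfl fun s _ => ?_
    rw [Finset.card_map]
    congr 3
    refine congrArg (· - 1) (numComponents_eq (φ := id) Function.surjective_id
      (reachable_map_iff Function.surjective_id ?_ ?_ ?_))
    · rintro u _ rfl
      exact SimpleGraph.Reachable.refl _
    · intro g hg u v huv
      rw [h₀] at huv
      exact reachable_of_ends (Finset.mem_coe.2 (Finset.mem_map_of_mem ι₀ hg)) huv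
    · intro g hg u v huv
      obtain ⟨g', hg', rfl⟩ := Finset.mem_map.1 (Finset.mem_coe.1 hg)
      rw [← h₀] at huv
      exact ⟨u, v, rfl, rfl, reachable_of_ends (Finset.mem_coe.2 hg') huv⟩
  · refine Finset.sum_congr rfl fun s _ => ?_
    have hfs : f ∉ s.map ι := fun hf => by
      obtain ⟨g, -, hg⟩ := Finset.mem_map.1 hf
      exact (hι f).1 ⟨g, hg⟩ rfl
    rw [Finset.card_insert_of_notMem hfs, Finset.card_map, pow_succ, mul_neg_one, neg_mul]
    congr 4
    refine congrArg (· - 1) (numComponents_eq hφ (reachable_map_iff hφ ?_ ?_ ?_)).symm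
    · intro u v huv
      rcases hker u v huv with rfl | huv
      · exact SimpleGraph.Reachable.refl _
      · exact reachable_of_ends (Finset.mem_coe.2 (Finset.mem_insert_self f _)) huv
    · intro g hg u v huv
      rcases Finset.mem_insert.1 (Finset.mem_coe.1 hg) with rfl | hg
      · rw [hf u v huv]
      · obtain ⟨g', hg', rfl⟩ := Finset.mem_map.1 hg
        refine reachable_of_ends (Finset.mem_coe.2 hg') ?_
        rw [h, huv, Sym2.map_mk]
    · intro g hg x y hxy
      rw [h] at hxy
      obtain ⟨u, v, huv⟩ : ∃ u v, Γ.ends (ι g) = s(u, v) :=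
        ⟨_, _, (Sym2.mk_surjective (Γ.ends (ι g))).choose_spec.symm⟩
      have hr : (Γ.state (insert f (s.map ι) : Finset E)).Reachable u v :=
        reachable_of_ends (Finset.mem_coe.2 (Finset.mem_insert_of_mem
          (Finset.mem_map_of_mem ι hg))) huv
      rw [huv, Sym2.map_mk, Sym2.eq_iff] at hxy
      rcases hxy with ⟨rfl, rfl⟩ | ⟨rfl, rfl⟩
      · exact ⟨u, v, rfl, rfl, hr⟩
      · exact ⟨v, u, rfl, rfl, hr.symm⟩

/-- Summed over all subsets of `t`, both sides become alternating sums over power sets, of the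
preimage of `t` and of `t`. These agree, because by surjectivity one set is empty exactly when the
other is. Induction cancels the proper subsets. -/
lemma sum_image_eq_neg_one_pow [Fintype E] {p : E → E'} (hp : Function.Surjective p)
    (t : Finset E') :
    ∑ s : Finset E with s.image p = t, (-1 : ℤ) ^ s.card = (-1) ^ t.card := by
  induction t using Finset.strongInduction with
  | H t ih =>
  have h1 : ∑ t' ∈ t.powerset, ∑ s : Finset E with s.image p = t', (-1 : ℤ) ^ s.card =
      ∑ t' ∈ t.powerset, (-1 : ℤ) ^ t'.card := by
    have hfib := Finset.sum_fiberwise_of_maps_to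
      (s := (Finset.univ.filter fun g => p g ∈ t).powerset) (t := t.powerset)
      (g := fun s => s.image p) (fun s hs => by
        rw [Finset.mem_powerset] at hs ⊢
        exact Finset.image_subset_iff.2 fun g hg => (Finset.mem_filter.1 (hs hg)).2)
      (fun s => (-1 : ℤ) ^ s.card)
    have hcongr : ∀ t' ∈ t.powerset, ∑ s : Finset E with s.image p = t', (-1 : ℤ) ^ s.card =
        ∑ s ∈ (Finset.univ.filter fun g => p g ∈ t).powerset with s.image p = t',
          (-1 : ℤ) ^ s.card := by
      intro t' ht'
      refine Finset.sum_congr ?_ fun _ _ => rfl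
      ext s
      simp only [Finset.mem_filter, Finset.mem_univ, true_and, Finset.mem_powerset]
      refine ⟨fun h => ⟨fun g hg => ?_, h⟩, fun h => h.2⟩
      rw [Finset.mem_filter]
      exact ⟨Finset.mem_univ _, Finset.mem_powerset.1 ht' (h ▸ Finset.mem_image_of_mem p hg)⟩
    rw [Finset.sum_congr rfl hcongr, hfib, Finset.sum_powerset_neg_one_pow_card,
      Finset.sum_powerset_neg_one_pow_card]
    refine if_congr ?_ rfl rfl
    rw [Finset.filter_eq_empty_iff, Finset.eq_empty_iff_forall_notMem]
    exact ⟨fun h x hx => by obtain ⟨g, rfl⟩ := hp x; exact h (Finset.mem_univ g) hx,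
      fun h g _ => h (p g)⟩
  have h2 : t.powerset = insert t t.ssubsets := by
    rw [Finset.ssubsets, Finset.insert_erase (Finset.mem_powerset_self t)]
  have h3 : t ∉ t.ssubsets := fun h => (Finset.mem_ssubsets.1 h).ne rfl
  rw [h2, Finset.sum_insert h3, Finset.sum_insert h3,
    Finset.sum_congr rfl fun t' ht' => ih t' (Finset.mem_ssubsets.1 ht')] at h1
  exact add_right_cancel h1

/-- Replacing parallel edges by single edges does not change the Euler characteristics. -/
theorem eulerChar_eq_of_surjective [Fintype E] [Fintype E'] {Γ' : IncidenceGraph V E'}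
    {p : E → E'} (hp : Function.Surjective p) (h : ∀ f, Γ'.ends (p f) = Γ.ends f) (j : ℕ) :
    Γ.eulerChar j = Γ'.eulerChar j := by
  have hcomp : ∀ s : Finset E, Γ.numComponents s = Γ'.numComponents (s.image p : Finset E') := by
    intro s
    unfold numComponents state
    rw [Finset.coe_image, Set.image_image]
    simp_rw [h]
  rw [eulerChar, ← Finset.sum_fiberwise _ (fun s => s.image p)]
  refine Finset.sum_congr rfl fun t _ => ?_
  rw [← sum_image_eq_neg_one_pow hp t, Finset.sum_mul]
  refine Finset.sum_congr rfl fun s hs => ?_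
  rw [hcomp, (Finset.mem_filter.1 hs).2]

/-- The contraction has `m` vertices, one fewer, so its exponents on the diagonal are smaller by
one: the extra sign turns the minus of `h` into a plus, and `X 0` restores the power. Its sum has no
term `j = m`, which `hm` compensates. -/
lemma sum_deletion_contraction {m : ℕ} {χ χ₀ χ₁ : ℕ → ℤ} (h : ∀ j, χ j = χ₀ j - χ₁ j)
    (hm : χ₁ m = 0) :
    (∑ j ∈ Finset.range (m + 1), MvPolynomial.C ((-1) ^ (m + 1 - 1 - j) * χ j) *
        MvPolynomial.X 0 ^ (m + 1 - 1 - j) * MvPolynomial.X 1 ^ j : MvPolynomial (Fin 2) ℤ) =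
      MvPolynomial.X 0 * ∑ j ∈ Finset.range m, MvPolynomial.C ((-1) ^ (m - 1 - j) * χ₁ j) *
        MvPolynomial.X 0 ^ (m - 1 - j) * MvPolynomial.X 1 ^ j +
      ∑ j ∈ Finset.range (m + 1), MvPolynomial.C ((-1) ^ (m + 1 - 1 - j) * χ₀ j) *
        MvPolynomial.X 0 ^ (m + 1 - 1 - j) * MvPolynomial.X 1 ^ j := by
  rw [Finset.sum_range_succ, Finset.sum_range_succ, Finset.mul_sum, ← add_assoc,
    ← Finset.sum_add_distrib, h m, hm, sub_zero]
  congr 1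
  refine Finset.sum_congr rfl fun j hj => ?_
  obtain ⟨k, rfl⟩ := Nat.exists_eq_add_of_lt (Finset.mem_range.1 hj)
  have h1 : j + k + 1 + 1 - 1 - j = k + 1 := by omega
  have h2 : j + k + 1 - 1 - j = k := by omega
  rw [h1, h2, h j]
  simp only [map_mul, map_sub, map_pow, map_neg, map_one]
  ring

end DeletionContraction

end IncidenceGraph

/-! ### Vertices, edges and connectedness of the contracted graph -/

section Contraction

open IncidenceGraph

variable {V : Type*} {e : Sym2 V}

instance [Finite V] : Finite (ContractedVertex e) :=
  Finite.of_surjective (ContractedVertex.mk e) Quot.exists_rep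

lemma ContractedVertex.mk_surjective : Function.Surjective (ContractedVertex.mk e) :=
  Quot.exists_rep

lemma ContractedVertex.mk_eq_of_eq {u v : V} (h : s(u, v) = e) :
    ContractedVertex.mk e u = ContractedVertex.mk e v :=
  Quot.sound h

/-- The relation consists of one unordered pair, so its equivalence closure adds only the diagonal.
-/
lemma ContractedVertex.eq_or_eq_of_mk_eq {u v : V}
    (h : ContractedVertex.mk e u = ContractedVertex.mk e v) : u = v ∨ s(u, v) = e := by
  have key : ∀ u v, Relation.EqvGen (fun u v : V => s(u, v) = e) u v → u = v ∨ s(u, v) = e := by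
    intro u v huv
    induction huv with
    | rel _ _ h => exact Or.inr h
    | refl => exact Or.inl rfl
    | symm x y _ ih => exact ih.imp Eq.symm fun h => Sym2.eq_swap.trans h
    | trans x y z _ _ ih₁ ih₂ =>
      rcases ih₁ with rfl | h₁
      · exact ih₂
      · rcases ih₂ with rfl | h₂
        · exact Or.inr h₁
        · rw [← h₂, Sym2.eq_iff] at h₁
          rcases h₁ with ⟨rfl, rfl⟩ | ⟨rfl, -⟩
          · exact Or.inr h₂
          · exact Or.inl rfl
  exact key u v (Quot.eqvGen_exact h)

lemma ContractedVertex.card [Finite V] (he : ¬ e.IsDiag) :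
    Nat.card V = Nat.card (ContractedVertex e) + 1 := by
  induction e with
  | _ a c =>
  have hac : a ≠ c := he
  have hbij : Function.Bijective fun v : {v : V // v ≠ c} => ContractedVertex.mk s(a, c) v := by
    constructor
    · rintro ⟨u, hu⟩ ⟨v, hv⟩ huv
      rcases ContractedVertex.eq_or_eq_of_mk_eq huv with h | h
      · exact Subtype.ext h
      · rw [Sym2.eq_iff] at h
        rcases h with ⟨-, h⟩ | ⟨h, -⟩
        · exact absurd h hv
        · exact absurd h hu
    · intro x
      obtain ⟨v, rfl⟩ := ContractedVertex.mk_surjective x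
      by_cases hv : v = c
      · subst hv
        exact ⟨⟨a, hac⟩, ContractedVertex.mk_eq_of_eq rfl⟩
      · exact ⟨⟨v, hv⟩, rfl⟩
  have := Fintype.ofFinite V
  classical
  rw [← Nat.card_eq_of_bijective _ hbij, Nat.card_eq_fintype_card, Nat.card_eq_fintype_card,
    Fintype.card_subtype_compl, Fintype.card_subtype_eq]
  have : 0 < Fintype.card V := Fintype.card_pos_iff.2 ⟨a⟩
  omega

lemma SimpleGraph.state_univ_toIncidenceGraph (G : SimpleGraph V) :
    G.toIncidenceGraph.state Set.univ = G := by
  unfold IncidenceGraph.state SimpleGraph.toIncidenceGraph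
  simp

/-- The ends of a non-bridge stay connected without it, so each passage through `e` can be replaced
by a detour. -/
lemma SimpleGraph.connected_deleteEdges {G : SimpleGraph V} (hG : G.Connected)
    (he : ¬ G.IsBridge e) : (G.deleteEdges {e}).Connected := by
  have := hG.nonempty
  refine ⟨fun u v => ?_⟩
  have h := hG.preconnected u v
  rw [← G.state_univ_toIncidenceGraph] at h
  refine IncidenceGraph.reachable_least (R := (G.deleteEdges {e}).Reachable)
    ⟨fun _ => SimpleGraph.Reachable.refl _, SimpleGraph.Reachable.symm,
      SimpleGraph.Reachable.trans⟩ (fun f _ x y hxy => ?_) h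
  have hadj : s(x, y) ∈ G.edgeSet := hxy ▸ f.2
  by_cases hxye : s(x, y) = e
  · subst hxye
    rwa [SimpleGraph.isBridge_iff, not_not] at he
  · exact SimpleGraph.Adj.reachable (by
      rw [SimpleGraph.deleteEdges_adj]; exact ⟨hadj, hxye⟩)

lemma SimpleGraph.connected_contractEdge {G : SimpleGraph V} (hG : G.Connected) :
    ((G.contractEdge e).state Set.univ).Connected := by
  have : Nonempty (ContractedVertex e) := hG.nonempty.map (ContractedVertex.mk e)
  refine ⟨fun x y => ?_⟩
  obtain ⟨u, rfl⟩ := ContractedVertex.mk_surjective x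
  obtain ⟨v, rfl⟩ := ContractedVertex.mk_surjective y
  have h := hG.preconnected u v
  rw [← G.state_univ_toIncidenceGraph] at h
  refine IncidenceGraph.reachable_least (R := fun u v => ((G.contractEdge e).state
    Set.univ).Reachable (ContractedVertex.mk e u) (ContractedVertex.mk e v))
    ⟨fun _ => SimpleGraph.Reachable.refl _, SimpleGraph.Reachable.symm,
      SimpleGraph.Reachable.trans⟩ (fun f _ x y hxy => ?_) h
  have hxy : f.1 = s(x, y) := hxy
  by_cases hfe : f.1 = e
  · rw [ContractedVertex.mk_eq_of_eq (hxy.symm.trans hfe)]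
  · refine IncidenceGraph.reachable_of_ends (Set.mem_univ (⟨f.1, f.2, hfe⟩ : ↥(G.edgeSet \ {e}))) ?_
    change Sym2.map _ f.1 = _
    rw [hxy, Sym2.map_mk]

/-- In a simple graph no other edge has the same ends as `e`, so contraction creates no loops. Hence
passing to a simple graph merges parallel edges but loses no edge. -/
lemma SimpleGraph.not_isDiag_map_mk {G : SimpleGraph V} {f : Sym2 V} (hf : f ∈ G.edgeSet \ {e}) :
    ¬ (Sym2.map (ContractedVertex.mk e) f).IsDiag := by
  induction f with
  | _ u v =>
  rw [Sym2.map_mk]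
  intro h
  rcases ContractedVertex.eq_or_eq_of_mk_eq h with rfl | h
  · exact G.loopless.irrefl u hf.1
  · exact hf.2 h

/-- The projection of the edges of `Γ / e` onto their classes of parallel edges. -/
def SimpleGraph.simplifyEdge (G : SimpleGraph V) (e : Sym2 V) (f : ↥(G.edgeSet \ {e})) :
    (G.simpleContractEdge e).edgeSet :=
  ⟨Sym2.map (ContractedVertex.mk e) f.1, by
    rw [SimpleGraph.simpleContractEdge, SimpleGraph.edgeSet_fromEdgeSet]
    exact ⟨⟨f.1, f.2, rfl⟩, not_isDiag_map_mk f.2⟩⟩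

lemma SimpleGraph.simplifyEdge_surjective (G : SimpleGraph V) :
    Function.Surjective (G.simplifyEdge e) := by
  rintro ⟨f, hf⟩
  have h := hf
  rw [SimpleGraph.simpleContractEdge, SimpleGraph.edgeSet_fromEdgeSet] at h
  obtain ⟨⟨g, hg, rfl⟩, -⟩ := h
  exact ⟨⟨g, hg⟩, rfl⟩

lemma SimpleGraph.connected_simpleContractEdge {G : SimpleGraph V} (hG : G.Connected) :
    (G.simpleContractEdge e).Connected := by
  have h := G.connected_contractEdge hG (e := e)
  convert h using 1
  unfold SimpleGraph.simpleContractEdge IncidenceGraph.state SimpleGraph.contractEdge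
  congr 1
  ext f
  simp

end Contraction

/-! ### The deletion-contraction formula -/

theorem mainTheorem9 {V : Type*} [Finite V] (G : SimpleGraph V) (hG : G.Connected)
    (e : Sym2 V) (he : e ∈ G.edgeSet) (hbridge : ¬ G.IsBridge e)
    (b : V) (ord : LinearOrder G.edgeSet)
    (bdel : V) (ord_del : LinearOrder (G.deleteEdges {e}).edgeSet)
    (bcon : ContractedVertex e) (ord_con : LinearOrder ↥(G.edgeSet \ {e}))
    (bsim : ContractedVertex e) (ord_sim : LinearOrder (G.simpleContractEdge e).edgeSet) :
    G.toIncidenceGraph.poincarePolynomial b ord =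
        MvPolynomial.X 0 * (G.contractEdge e).poincarePolynomial bcon ord_con +
          (G.deleteEdges {e}).toIncidenceGraph.poincarePolynomial bdel ord_del ∧
      G.toIncidenceGraph.poincarePolynomial b ord =
        MvPolynomial.X 0 *
            (G.simpleContractEdge e).toIncidenceGraph.poincarePolynomial bsim ord_sim +
          (G.deleteEdges {e}).toIncidenceGraph.poincarePolynomial bdel ord_del := by
  have := Fintype.ofFinite G.edgeSet
  have := Fintype.ofFinite (G.deleteEdges {e}).edgeSet
  have := Fintype.ofFinite ↥(G.edgeSet \ {e})
  have := Fintype.ofFinite (G.simpleContractEdge e).edgeSet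
  have : Nonempty (ContractedVertex e) := ⟨bcon⟩
  have hcard := ContractedVertex.card (G.not_isDiag_of_mem_edgeSet he)
  have hsimple := fun j => IncidenceGraph.eulerChar_eq_of_surjective (Γ := G.contractEdge e)
    (Γ' := (G.simpleContractEdge e).toIncidenceGraph) (G.simplifyEdge_surjective (e := e))
    (fun _ => rfl) j
  have hchi := fun j => IncidenceGraph.eulerChar_deletion_contraction
    (Γ := G.toIncidenceGraph) (Γ₀ := (G.deleteEdges {e}).toIncidenceGraph)
    (Γ' := G.contractEdge e) (f := ⟨e, he⟩)
    (ι₀ := ⟨fun f => ⟨f.1, SimpleGraph.edgeSet_mono (G.deleteEdges_le {e}) f.2⟩,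
      fun f g h => Subtype.ext (congrArg (fun x : G.edgeSet => x.1) h)⟩)
    (hι₀ := fun g => by
      constructor
      · rintro ⟨f, rfl⟩ h
        exact ((Set.ext_iff.1 (G.edgeSet_deleteEdges {e}) f.1).1 f.2).2 (congrArg Subtype.val h)
      · intro h
        refine ⟨⟨g.1, ?_⟩, rfl⟩
        rw [SimpleGraph.edgeSet_deleteEdges]
        exact ⟨g.2, fun h' => h (Subtype.ext h')⟩)
    (h₀ := fun _ => rfl)
    (ι := ⟨fun f => ⟨f.1, f.2.1⟩,
      fun f g h => Subtype.ext (congrArg (fun x : G.edgeSet => x.1) h)⟩)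
    (hι := fun g => by
      constructor
      · rintro ⟨f, rfl⟩ h
        exact f.2.2 (congrArg Subtype.val h)
      · exact fun h => ⟨⟨g.1, g.2, fun h' => h (Subtype.ext h')⟩, rfl⟩)
    (φ := ContractedVertex.mk e) ContractedVertex.mk_surjective
    (hker := fun u v h => (ContractedVertex.eq_or_eq_of_mk_eq h).imp_right Eq.symm)
    (hf := fun u v h => ContractedVertex.mk_eq_of_eq h.symm) (h := fun _ => rfl) j
  -- Supplies the missing top term: the contraction has one vertex, and so one degree, fewer.
  have hzero : (G.contractEdge e).eulerChar (Nat.card (ContractedVertex e)) = 0 :=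
    IncidenceGraph.eulerChar_eq_zero
  have hG' := hG
  rw [← G.state_univ_toIncidenceGraph] at hG'
  have hdel := G.connected_deleteEdges hG hbridge
  rw [← (G.deleteEdges {e}).state_univ_toIncidenceGraph] at hdel
  have hsim := G.connected_simpleContractEdge hG (e := e)
  rw [← (G.simpleContractEdge e).state_univ_toIncidenceGraph] at hsim
  -- From here on base vertices and edge orders no longer occur; by `hsimple` the two claims become
  -- the same identity.
  rw [IncidenceGraph.poincarePolynomial_eq ord hG',
    IncidenceGraph.poincarePolynomial_eq ord_con (G.connected_contractEdge hG),
    IncidenceGraph.poincarePolynomial_eq ord_del hdel,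
    IncidenceGraph.poincarePolynomial_eq ord_sim hsim, hcard]
  simp_rw [← hsimple]
  exact ⟨IncidenceGraph.sum_deletion_contraction hchi hzero,
    IncidenceGraph.sum_deletion_contraction hchi hzero⟩
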